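/- **Theorem 1.2 (semiconj_dichot).** Let $I=[0,1]$ and let $\mathrm{PL}_+(I)$ be the group of orientation preserving homeomorphisms of $I$ that are piecewise linear (with finitely many breakpoints). The support of a homeomorphism $g$ of $I$ is $\operatorname{supt}(g)=\{x\in I : g(x)\neq x\}$. For a subgroup $G\le \mathrm{PL}_+(I)$, the support of $G$ is $\bigcup_{g\in G}\operatorname{supt}(g)$, and an orbital of $G$ is a connected component of the support of $G$. An orbital $J$ of $G$ is resolvable if $\{\operatorname{supt}(g)\cap J : g\in G\}$ is a base for the topology of $J$. Let $G\le \mathrm{PL}_+(I)$, let $J$ be a resolvable orbital of $G$, and let $K_i$ $(i<n)$ be a finite sequence of orbitals of $G$. Then exactly one of the following is true: 1. there is a $g\in G$ whose support intersects $J$ but is disjoint from $K_i$ for all $i<n$; 2. there are an $i<n$ and a monotone (that is, order preserving or order reversing) surjection $\psi:K_i\to J$ which is $G$-equivariant, meaning that $K_i$ is $G$-invariant and $\psi(g(x))=g(\psi(x))$ for all $g\in G$ and $x\in K_i$. -/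

import Mathlib

open scoped unitInterval

/-- The group of orientation preserving homeomorphisms of the unit interval. -/
def HomeoPlus : Subgroup (I ≃ₜ I) where
  carrier := {f | StrictMono f}
  one_mem' := strictMono_id
  mul_mem' := fun {f g} (hf : StrictMono f) (hg : StrictMono g) => hf.comp hg
  inv_mem' := fun {f} hf x y hxy => by
    change f.symm x < f.symm y
    rw [← hf.lt_iff_lt]
    simpa using hxy

/-- A self-map of the unit interval is piecewise linear if there is a finite set `B` such that
the map is affine on every closed interval whose interior contains no point of `B`. -/
def IsPiecewiseLinear (f : I → I) : Prop :=
  ∃ B : Set I, B.Finite ∧ ∀ x y : I, x < y → Disjoint (Set.Ioo x y) B →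
    ∃ a b : ℝ, ∀ z ∈ Set.Icc x y, ((f z : I) : ℝ) = a * (z : ℝ) + b

/-- The group of piecewise linear orientation preserving homeomorphisms of the unit interval. -/
def PLPlus : Subgroup (I ≃ₜ I) where
  carrier := {f | f ∈ HomeoPlus ∧ IsPiecewiseLinear f}
  one_mem' := ⟨HomeoPlus.one_mem, ∅, Set.finite_empty, fun _ _ _ _ => ⟨1, 0, fun z _ => by simp⟩⟩
  mul_mem' := by
    rintro f g ⟨hf, B, hB, hfB⟩ ⟨hg, C, hC, hgC⟩
    have hg' : StrictMono g := hg
    refine ⟨HomeoPlus.mul_mem hf hg, C ∪ g ⁻¹' B,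
      hC.union (hB.preimage g.injective.injOn), fun x y hxy hd => ?_⟩
    rw [Set.disjoint_union_right] at hd
    obtain ⟨a, b, hab⟩ := hgC x y hxy hd.1
    have hd2 : Disjoint (Set.Ioo (g x) (g y)) B := by
      rw [Set.disjoint_left]
      rintro w ⟨h1, h2⟩ hw
      obtain ⟨v, rfl⟩ := g.surjective w
      exact Set.disjoint_left.1 hd.2 ⟨hg'.lt_iff_lt.1 h1, hg'.lt_iff_lt.1 h2⟩ hw
    obtain ⟨c, d, hcd⟩ := hfB (g x) (g y) (hg' hxy) hd2
    refine ⟨c * a, c * b + d, fun z hz => ?_⟩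
    have h1 := hcd (g z) ⟨hg'.monotone hz.1, hg'.monotone hz.2⟩
    have h2 := hab z hz
    change ((f (g z) : I) : ℝ) = _
    rw [h1, h2]
    ring
  inv_mem' := by
    rintro f ⟨hf, B, hB, hfB⟩
    have hfi : StrictMono f.symm := HomeoPlus.inv_mem hf
    refine ⟨HomeoPlus.inv_mem hf, f.symm ⁻¹' B, hB.preimage f.symm.injective.injOn,
      fun x y hxy hd => ?_⟩
    have hd2 : Disjoint (Set.Ioo (f.symm x) (f.symm y)) B := by
      rw [Set.disjoint_left]
      rintro w ⟨h1, h2⟩ hw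
      obtain ⟨v, rfl⟩ := f.symm.surjective w
      exact Set.disjoint_left.1 hd ⟨hfi.lt_iff_lt.1 h1, hfi.lt_iff_lt.1 h2⟩ hw
    obtain ⟨a, b, hab⟩ := hfB _ _ (hfi hxy) hd2
    have hx := hab (f.symm x) ⟨le_rfl, (hfi hxy).le⟩
    have hy := hab (f.symm y) ⟨(hfi hxy).le, le_rfl⟩
    rw [f.apply_symm_apply] at hx hy
    have ha : a ≠ 0 := by
      rintro rfl
      have h : (x : ℝ) < y := hxy
      linarith
    refine ⟨a⁻¹, -(a⁻¹ * b), fun z hz => ?_⟩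
    have h := hab (f.symm z) ⟨hfi.monotone hz.1, hfi.monotone hz.2⟩
    rw [f.apply_symm_apply] at h
    change ((f.symm z : I) : ℝ) = _
    rw [h]
    field_simp
    ring

/-- The support of a homeomorphism: the set of points that it moves (no closure is taken). -/
def supt (g : I ≃ₜ I) : Set I := {x | g x ≠ x}

/-- The support of a group of homeomorphisms. -/
def suptGroup (G : Subgroup (I ≃ₜ I)) : Set I := ⋃ g ∈ G, supt g

/-- An orbital of `G` is a connected component of the support of `G`. -/
def IsOrbital (G : Subgroup (I ≃ₜ I)) (J : Set I) : Prop :=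
  ∃ x ∈ suptGroup G, J = connectedComponentIn (suptGroup G) x

/-- An orbital `J` of `G` is resolvable if the sets `supt g ∩ J`, for `g ∈ G`, form a base for
the (subspace) topology of `J`. -/
def IsResolvableOrbital (G : Subgroup (I ≃ₜ I)) (J : Set I) : Prop :=
  IsOrbital G J ∧
    TopologicalSpace.IsTopologicalBasis {W : Set J | ∃ g ∈ G, W = (↑) ⁻¹' (supt g ∩ J)}

/-- A partial function `ψ` from the unit interval to itself with domain `D` is `G`-equivariant if
`D` is `G`-invariant and `ψ (g x) = g (ψ x)` for all `g ∈ G` and `x ∈ D`. -/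
def IsEquivariantMap (G : Subgroup (I ≃ₜ I)) (D : Set I) (ψ : D → I) : Prop :=
  ∀ g ∈ G, ∀ x : D, ∃ h : g x ∈ D, ψ ⟨g x, h⟩ = g (ψ x)

namespace SemiconjDichotomy

open Set Filter Topology

/-! Write `J = Ioo p q` and let `R(a,b)` consist of the elements of `G` whose support within `J`
lies in `Ioo a b`. Resolvability makes every subinterval `Ioo a b` of `J` an orbital of `R(a,b)`. An
orbital of `R(a,b)` is good if the elements of `R(a,b)` trivial on it are trivial on `J`.

If the first alternative fails, the action on the union of the `K i` determines the action on `J`,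
and `Resolves.exists_isGood` finds a single `K i` that already does so. The reason is that two
normal subgroups of `R(a,b)` acting non-trivially on `J` have an intersection acting non-trivially
on `J` (`Resolves.exists_moves_inf`), while a piecewise linear element is non-trivial on finitely
many orbitals only.

Fix such a good orbital `Ioo k l` of `G`. Goodness passes to larger and to smaller subintervals
(`Resolves.isGood_of_le`, `IsGood.exists_isGood`), and each `R(a,b)` has a leftmost good orbital in
`Ioo k l`. This choice is equivariant and monotone under inclusion. By `IsLeftmost.disjoint` it also
preserves disjointness: germs at an endpoint of an orbital are affine, so commutators are trivial
there, and two of them can be made to commute on a shared orbital without changing their commutator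
on `J`. Hence the choice preserves or reverses the order (`forall_image_le_or`), and suprema turn it
into `ψ`, which is onto because orbits are dense in `J` (`Resolves.exists_monotone_semiconj`).

The alternatives exclude each other: if `g` is trivial on `K i`, equivariance makes it trivial on
the image of `ψ`, which is `J`. -/

theorem inv_apply_eq_of_apply_eq {g : I ≃ₜ I} {x : I} (h : g x = x) : g⁻¹ x = x := by
  conv_lhs => rw [← h]
  simp

theorem apply_inv_apply (g : I ≃ₜ I) (x : I) : g (g⁻¹ x) = x := g.apply_symm_apply x

theorem inv_apply_apply (g : I ≃ₜ I) (x : I) : g⁻¹ (g x) = x := g.symm_apply_apply x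

/-- The interval with endpoints `e` and `f` is an orbital of `L`. -/
def IsOrb (L : Subgroup (I ≃ₜ I)) (e f : I) : Prop :=
  e < f ∧ (∀ g ∈ L, g e = e ∧ g f = f) ∧ ∀ x ∈ Ioo e f, ∃ g ∈ L, g x ≠ x

/-- The elements of `G` that fix every point of `S`. -/
def fixer (G : Subgroup (I ≃ₜ I)) (S : Set I) : Subgroup (I ≃ₜ I) where
  carrier := {g | g ∈ G ∧ ∀ x ∈ S, g x = x}
  one_mem' := ⟨G.one_mem, fun _ _ => rfl⟩
  mul_mem' := fun {f g} hf hg => ⟨G.mul_mem hf.1 hg.1, fun x hx => by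
    change f (g x) = x
    rw [hg.2 x hx, hf.2 x hx]⟩
  inv_mem' := fun {f} hf => ⟨G.inv_mem hf.1, fun x hx => inv_apply_eq_of_apply_eq (hf.2 x hx)⟩

theorem fixer_le (G : Subgroup (I ≃ₜ I)) (S : Set I) : fixer G S ≤ G := fun _ h => h.1

/-! ### Orbitals as open intervals between common fixed points -/

section Orb

variable {L : Subgroup (I ≃ₜ I)}

theorem isClosed_setOf_fixed (L : Subgroup (I ≃ₜ I)) : IsClosed {x : I | ∀ g ∈ L, g x = x} := by
  have : {x : I | ∀ g ∈ L, g x = x} = ⋂ g ∈ L, {x | g x = x} := by ext; simp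
  rw [this]
  exact isClosed_biInter fun g _ => isClosed_eq g.continuous continuous_id

theorem apply_zero_of_strictMono {g : I ≃ₜ I} (hg : StrictMono g) : g 0 = 0 := by
  obtain ⟨y, hy⟩ := g.surjective 0
  have : g 0 ≤ g y := hg.monotone (unitInterval.nonneg' : (0 : I) ≤ y)
  exact le_antisymm (hy ▸ this) unitInterval.nonneg'

theorem apply_one_of_strictMono {g : I ≃ₜ I} (hg : StrictMono g) : g 1 = 1 := by
  obtain ⟨y, hy⟩ := g.surjective 1
  have : g y ≤ g 1 := hg.monotone (unitInterval.le_one' : y ≤ (1 : I))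
  exact le_antisymm unitInterval.le_one' (hy ▸ this)

/-- Every moved point lies in an orbital. -/
theorem exists_isOrb (hL : L ≤ HomeoPlus) {x : I} (hx : ∃ g ∈ L, g x ≠ x) :
    ∃ e f, IsOrb L e f ∧ x ∈ Ioo e f := by
  have hcl := isClosed_setOf_fixed L
  set F := {x : I | ∀ g ∈ L, g x = x} with hF
  have hxF : x ∉ F := by
    rintro h
    obtain ⟨g, hg, hgx⟩ := hx
    exact hgx (h g hg)
  have h0 : (0 : I) ∈ F := fun g hg => apply_zero_of_strictMono (hL hg)
  have h1 : (1 : I) ∈ F := fun g hg => apply_one_of_strictMono (hL hg)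
  have he : sSup (F ∩ Iic x) ∈ F ∩ Iic x :=
    (hcl.inter isClosed_Iic).csSup_mem ⟨0, h0, unitInterval.nonneg'⟩ (OrderTop.bddAbove _)
  have hf : sInf (F ∩ Ici x) ∈ F ∩ Ici x :=
    (hcl.inter isClosed_Ici).csInf_mem ⟨1, h1, unitInterval.le_one'⟩ (OrderBot.bddBelow _)
  have hex : sSup (F ∩ Iic x) < x := lt_of_le_of_ne he.2 fun h => hxF (h ▸ he.1)
  have hxf : x < sInf (F ∩ Ici x) := lt_of_le_of_ne hf.2 fun h => hxF (h ▸ hf.1)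
  refine ⟨_, _, ⟨hex.trans hxf, fun g hg => ⟨he.1 g hg, hf.1 g hg⟩, fun y hy => ?_⟩, hex, hxf⟩
  by_contra! hy'
  rcases le_total y x with h | h
  · exact absurd (le_sSup (show y ∈ F ∩ Iic x from ⟨hy', h⟩)) hy.1.not_ge
  · exact absurd (sInf_le (show y ∈ F ∩ Ici x from ⟨hy', h⟩)) hy.2.not_ge

/-- An orbital that meets an interval with fixed endpoints lies in it. -/
theorem IsOrb.le_of_fixed {e f e' f' x : I} (h : IsOrb L e f) (he : ∀ g ∈ L, g e' = e')
    (hf : ∀ g ∈ L, g f' = f') (hx : x ∈ Ioo e f) (hx' : x ∈ Ioo e' f') : e' ≤ e ∧ f ≤ f' := by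
  constructor
  · by_contra! hc
    obtain ⟨g, hg, hne⟩ := h.2.2 e' ⟨hc, hx'.1.trans hx.2⟩
    exact hne (he g hg)
  · by_contra! hc
    obtain ⟨g, hg, hne⟩ := h.2.2 f' ⟨hx.1.trans hx'.2, hc⟩
    exact hne (hf g hg)

theorem IsOrb.eq_of_mem {e f e' f' x : I} (h : IsOrb L e f) (h' : IsOrb L e' f')
    (hx : x ∈ Ioo e f) (hx' : x ∈ Ioo e' f') : e = e' ∧ f = f' := by
  have h1 := h.le_of_fixed (fun g hg => (h'.2.1 g hg).1) (fun g hg => (h'.2.1 g hg).2) hx hx'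
  have h2 := h'.le_of_fixed (fun g hg => (h.2.1 g hg).1) (fun g hg => (h.2.1 g hg).2) hx' hx
  exact ⟨le_antisymm h2.1 h1.1, le_antisymm h1.2 h2.2⟩

theorem mem_Ioo_of_fixed {g : I ≃ₜ I} (hg : StrictMono g) {e f x : I} (he : g e = e) (hf : g f = f)
    (hx : x ∈ Ioo e f) : g x ∈ Ioo e f :=
  ⟨by simpa [he] using hg hx.1, by simpa [hf] using hg hx.2⟩

theorem IsOrb.apply_mem (hL : L ≤ HomeoPlus) {e f x : I} (h : IsOrb L e f) {g : I ≃ₜ I}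
    (hg : g ∈ L) (hx : x ∈ Ioo e f) : g x ∈ Ioo e f :=
  mem_Ioo_of_fixed (hL hg) (h.2.1 g hg).1 (h.2.1 g hg).2 hx

theorem IsOrb.nonempty {e f : I} (h : IsOrb L e f) : (Ioo e f).Nonempty := exists_between h.1

/-- An orbital given as a connected component is an interval. -/
theorem exists_isOrb_of_isOrbital (hL : L ≤ HomeoPlus) {C : Set I} (hC : IsOrbital L C) :
    ∃ e f, IsOrb L e f ∧ C = Ioo e f := by
  obtain ⟨x, hx, rfl⟩ := hC
  have hmem : ∀ y, y ∈ suptGroup L ↔ ∃ g ∈ L, g y ≠ y := fun y => by simp [suptGroup, supt]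
  obtain ⟨e, f, h, hxe⟩ := exists_isOrb hL ((hmem x).1 hx)
  refine ⟨e, f, h, Subset.antisymm ?_ ?_⟩
  · have hsub := connectedComponentIn_subset (suptGroup L) x
    have hconn : (connectedComponentIn (suptGroup L) x).OrdConnected :=
      isPreconnected_connectedComponentIn.ordConnected
    have hxm := mem_connectedComponentIn hx
    have he : e ∉ suptGroup L := fun he => by
      obtain ⟨g, hg, hne⟩ := (hmem e).1 he
      exact hne (h.2.1 g hg).1
    have hf : f ∉ suptGroup L := fun hf => by
      obtain ⟨g, hg, hne⟩ := (hmem f).1 hf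
      exact hne (h.2.1 g hg).2
    intro y hy
    constructor
    · by_contra! hc
      exact he (hsub (hconn.out hy hxm ⟨hc, hxe.1.le⟩))
    · by_contra! hc
      exact hf (hsub (hconn.out hxm hy ⟨hxe.2.le, hc⟩))
  · exact isPreconnected_Ioo.subset_connectedComponentIn hxe
      fun y hy => (hmem y).2 (h.2.2 y hy)

theorem lt_inv_apply_of_apply_lt {g : I ≃ₜ I} (hg : StrictMono g) {x y : I} (h : g x < y) :
    x < g⁻¹ y := by
  rw [← hg.lt_iff_lt, apply_inv_apply]; exact h

theorem inv_apply_lt_of_lt_apply {g : I ≃ₜ I} (hg : StrictMono g) {x y : I} (h : x < g y) :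
    g⁻¹ x < y := by
  rw [← hg.lt_iff_lt, apply_inv_apply]; exact h

theorem exists_lt_apply_of_ne (hL : L ≤ HomeoPlus) {x : I} (h : ∃ g ∈ L, g x ≠ x) :
    ∃ g ∈ L, x < g x := by
  obtain ⟨g, hg, hne⟩ := h
  rcases hne.lt_or_gt with h | h
  · exact ⟨g⁻¹, L.inv_mem hg, lt_inv_apply_of_apply_lt (hL hg) h⟩
  · exact ⟨g, hg, h⟩

/-- Orbits are cofinal in orbitals. -/
theorem IsOrb.exists_lt_apply (hL : L ≤ HomeoPlus) {e f x y : I} (h : IsOrb L e f)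
    (hx : x ∈ Ioo e f) (hy : y ∈ Ioo e f) : ∃ g ∈ L, y < g x := by
  by_contra! hc
  -- The supremum of a bounded orbit would be an interior point of the orbital. Some `g` moves it to
  -- the right, and then `g` carries a nearby orbit point beyond the supremum.
  set S := {z | ∃ g ∈ L, g x = z} with hS
  have hle : sSup S ≤ y := sSup_le (by rintro _ ⟨g, hg, rfl⟩; exact hc g hg)
  have hxs : x ≤ sSup S := le_sSup ⟨1, L.one_mem, rfl⟩
  obtain ⟨g, hg, hlt⟩ := exists_lt_apply_of_ne hL
    (h.2.2 (sSup S) ⟨hx.1.trans_le hxs, hle.trans_lt hy.2⟩)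
  have h2 := inv_apply_lt_of_lt_apply (hL hg) hlt
  obtain ⟨_, ⟨k, hk, rfl⟩, hlt'⟩ := lt_sSup_iff.1 h2
  have h3 : sSup S < g (k x) := by
    have := (hL hg : StrictMono g) hlt'
    rwa [apply_inv_apply] at this
  exact absurd (le_sSup (show g (k x) ∈ S from ⟨g * k, L.mul_mem hg hk, rfl⟩)) h3.not_ge

/-- Orbits are coinitial in orbitals. -/
theorem IsOrb.exists_apply_lt (hL : L ≤ HomeoPlus) {e f x y : I} (h : IsOrb L e f)
    (hx : x ∈ Ioo e f) (hy : y ∈ Ioo e f) : ∃ g ∈ L, g x < y := by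
  obtain ⟨g, hg, hlt⟩ := h.exists_lt_apply hL hy hx
  exact ⟨g⁻¹, L.inv_mem hg, inv_apply_lt_of_lt_apply (hL hg) hlt⟩

end Orb

/-! ### Consequences of piecewise linearity -/

section PL

variable {L : Subgroup (I ≃ₜ I)}

theorem PLPlus_le_HomeoPlus : PLPlus ≤ HomeoPlus := fun _ h => h.1

/-- An element of a piecewise linear group is non-trivial on finitely many orbitals only. -/
theorem finite_isOrb_moved (hL : L ≤ PLPlus) {g : I ≃ₜ I} (hg : g ∈ L) :
    {P : I × I | IsOrb L P.1 P.2 ∧ ∃ x ∈ Ioo P.1 P.2, g x ≠ x}.Finite := by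
  obtain ⟨B, hB, hgB⟩ := (hL hg).2
  -- An affine map that fixes both endpoints is the identity, so a non-trivially moved orbital
  -- contains a breakpoint. Distinct orbitals are disjoint, so these breakpoints are distinct.
  have key : ∀ P ∈ {P : I × I | IsOrb L P.1 P.2 ∧ ∃ x ∈ Ioo P.1 P.2, g x ≠ x},
      ∃ b ∈ B, b ∈ Ioo P.1 P.2 := by
    rintro ⟨e, f⟩ ⟨h, x, hx, hne⟩
    by_contra! hc
    obtain ⟨a, b, hab⟩ := hgB e f h.1 (disjoint_left.2 fun y hy hyB => hc y hyB hy)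
    have he := hab e ⟨le_rfl, h.1.le⟩
    have hf := hab f ⟨h.1.le, le_rfl⟩
    rw [(h.2.1 g hg).1] at he
    rw [(h.2.1 g hg).2] at hf
    have hef : (e : ℝ) < f := h.1
    have ha : a = 1 := by
      have : (a - 1) * ((f : ℝ) - e) = 0 := by linarith
      rcases mul_eq_zero.1 this with h | h <;> linarith
    have hb : b = 0 := by subst ha; linarith
    refine hne (Subtype.ext ?_)
    rw [hab x (Ioo_subset_Icc_self hx), ha, hb]
    ring
  choose! φ hφ using key
  refine Set.Finite.of_injOn (f := φ) (t := B) (fun P hP => (hφ P hP).1) ?_ hB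
  intro P hP Q hQ hPQ
  have h1 := (hφ P hP).2
  have h2 := (hφ Q hQ).2
  rw [← hPQ] at h2
  have := hP.1.eq_of_mem hQ.1 h1 h2
  exact Prod.ext this.1 this.2

theorem eventually_affine_right {g : I ≃ₜ I} (hg : g ∈ PLPlus) {e f : I} (hef : e < f) :
    ∃ a b : ℝ, ∀ᶠ x in 𝓝[>] e, ((g x : I) : ℝ) = a * x + b := by
  obtain ⟨B, hB, hgB⟩ := hg.2
  -- The endpoint `e` may itself be a breakpoint, which is harmless for a one-sided germ.
  have h1 : (B \ {e})ᶜ ∈ 𝓝[>] e :=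
    mem_nhdsWithin_of_mem_nhds ((hB.subset sdiff_subset).isClosed.isOpen_compl.mem_nhds (by simp))
  obtain ⟨u, hu, hsub⟩ := (mem_nhdsGT_iff_exists_Ioo_subset' hef).1 h1
  obtain ⟨a, b, hab⟩ := hgB e u hu (disjoint_left.2 fun y hy hyB => hsub hy ⟨hyB, hy.1.ne'⟩)
  exact ⟨a, b, by
    filter_upwards [Ioo_mem_nhdsGT hu] with x hx using hab x (Ioo_subset_Icc_self hx)⟩

theorem eventually_affine_left {g : I ≃ₜ I} (hg : g ∈ PLPlus) {e f : I} (hef : e < f) :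
    ∃ a b : ℝ, ∀ᶠ x in 𝓝[<] f, ((g x : I) : ℝ) = a * x + b := by
  obtain ⟨B, hB, hgB⟩ := hg.2
  have h1 : (B \ {f})ᶜ ∈ 𝓝[<] f :=
    mem_nhdsWithin_of_mem_nhds ((hB.subset sdiff_subset).isClosed.isOpen_compl.mem_nhds (by simp))
  obtain ⟨u, hu, hsub⟩ := (mem_nhdsLT_iff_exists_Ioo_subset' hef).1 h1
  obtain ⟨a, b, hab⟩ := hgB u f hu (disjoint_left.2 fun y hy hyB => hsub hy ⟨hyB, hy.2.ne⟩)
  exact ⟨a, b, by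
    filter_upwards [Ioo_mem_nhdsLT hu] with x hx using hab x (Ioo_subset_Icc_self hx)⟩

/-- The homeomorphisms whose germ along `l` is trivial. -/
def germTrivial (l : Filter I) : Subgroup (I ≃ₜ I) where
  carrier := {g | ∀ᶠ x in l, g x = x}
  one_mem' := Eventually.of_forall fun _ => rfl
  mul_mem' := fun {f g} (hf : ∀ᶠ x in l, f x = x) (hg : ∀ᶠ x in l, g x = x) => by
    filter_upwards [hf, hg] with x h1 h2
    change f (g x) = x
    rw [h2, h1]
  inv_mem' := fun {f} (hf : ∀ᶠ x in l, f x = x) => by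
    filter_upwards [hf] with x h1 using inv_apply_eq_of_apply_eq h1

/-- Affine maps with a common fixed point commute. A general filter `l` lets one argument serve both
sides of `e`. -/
theorem eventually_commutator {l : Filter I} {e : I} (hl : l ≤ 𝓝 e) {g h : I ≃ₜ I}
    (hgl : Tendsto g l l) (hhl : Tendsto h l l)
    (hgl' : Tendsto (g⁻¹ : I ≃ₜ I) l l) (hhl' : Tendsto (h⁻¹ : I ≃ₜ I) l l)
    (hge : g e = e) (hhe : h e = e)
    (hga : ∃ a b : ℝ, ∀ᶠ x in l, ((g x : I) : ℝ) = a * x + b)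
    (hha : ∃ a b : ℝ, ∀ᶠ x in l, ((h x : I) : ℝ) = a * x + b) :
    ∀ᶠ x in l, (g * h * g⁻¹ * h⁻¹) x = x := by
  rcases l.eq_or_neBot with rfl | hne
  · simp
  obtain ⟨a, b, hab⟩ := hga
  obtain ⟨c, d, hcd⟩ := hha
  have hlim : Tendsto (fun x : I => (x : ℝ)) l (𝓝 (e : ℝ)) :=
    (continuous_subtype_val.tendsto e).mono_left hl
  have fixed : ∀ {k : I ≃ₜ I} {a b : ℝ}, k e = e → (∀ᶠ x in l, ((k x : I) : ℝ) = a * x + b) →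
      (e : ℝ) = a * e + b := by
    intro k a b hk hab
    have h1 : Tendsto (fun x : I => ((k x : I) : ℝ)) l (𝓝 (e : ℝ)) := by
      have := ((continuous_subtype_val.comp k.continuous).tendsto e).mono_left hl
      simpa [hk, Function.comp_def] using this
    exact tendsto_nhds_unique (h1.congr' hab) ((hlim.const_mul a).add_const b)
  have e1 := fixed hge hab
  have e2 := fixed hhe hcd
  have hcomm : ∀ᶠ x in l, g (h x) = h (g x) := by
    filter_upwards [hab, hcd, hhl.eventually hab, hgl.eventually hcd] with x h1 h2 h3 h4
    apply Subtype.ext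
    rw [h3, h4, h1, h2]
    linear_combination (c - 1) * e1 + (1 - a) * e2
  filter_upwards [(hgl'.comp hhl').eventually hcomm] with x hx
  change g (h (g⁻¹ (h⁻¹ x))) = x
  simp only [Function.comp_apply] at hx
  rw [hx, apply_inv_apply, apply_inv_apply]

theorem tendsto_nhdsGT_of_fixed {g : I ≃ₜ I} (hg : StrictMono g) {e : I} (he : g e = e) :
    Tendsto g (𝓝[>] e) (𝓝[>] e) := by
  refine tendsto_nhdsWithin_iff.2 ⟨?_, ?_⟩
  · simpa [he] using (g.continuous.tendsto e).mono_left nhdsWithin_le_nhds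
  · filter_upwards [self_mem_nhdsWithin] with x hx
    simpa [he] using hg (mem_Ioi.1 hx)

theorem tendsto_nhdsLT_of_fixed {g : I ≃ₜ I} (hg : StrictMono g) {e : I} (he : g e = e) :
    Tendsto g (𝓝[<] e) (𝓝[<] e) := by
  refine tendsto_nhdsWithin_iff.2 ⟨?_, ?_⟩
  · simpa [he] using (g.continuous.tendsto e).mono_left nhdsWithin_le_nhds
  · filter_upwards [self_mem_nhdsWithin] with x hx
    simpa [he] using hg (mem_Iio.1 hx)

open scoped commutatorElement in
theorem commutator_le_germTrivial_right (hL : L ≤ PLPlus) {e f : I} (h : IsOrb L e f) :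
    ⁅L, L⁆ ≤ germTrivial (𝓝[>] e) := by
  refine Subgroup.commutator_le.2 fun g hg k hk => ?_
  have hm : ∀ g ∈ L, StrictMono g := fun g hg => (hL hg).1
  exact eventually_commutator nhdsWithin_le_nhds
    (tendsto_nhdsGT_of_fixed (hm g hg) (h.2.1 g hg).1)
    (tendsto_nhdsGT_of_fixed (hm k hk) (h.2.1 k hk).1)
    (tendsto_nhdsGT_of_fixed (hm _ (L.inv_mem hg)) (h.2.1 _ (L.inv_mem hg)).1)
    (tendsto_nhdsGT_of_fixed (hm _ (L.inv_mem hk)) (h.2.1 _ (L.inv_mem hk)).1)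
    (h.2.1 g hg).1 (h.2.1 k hk).1
    (eventually_affine_right (hL hg) h.1) (eventually_affine_right (hL hk) h.1)

open scoped commutatorElement in
theorem commutator_le_germTrivial_left (hL : L ≤ PLPlus) {e f : I} (h : IsOrb L e f) :
    ⁅L, L⁆ ≤ germTrivial (𝓝[<] f) := by
  refine Subgroup.commutator_le.2 fun g hg k hk => ?_
  have hm : ∀ g ∈ L, StrictMono g := fun g hg => (hL hg).1
  exact eventually_commutator nhdsWithin_le_nhds
    (tendsto_nhdsLT_of_fixed (hm g hg) (h.2.1 g hg).2)
    (tendsto_nhdsLT_of_fixed (hm k hk) (h.2.1 k hk).2)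
    (tendsto_nhdsLT_of_fixed (hm _ (L.inv_mem hg)) (h.2.1 _ (L.inv_mem hg)).2)
    (tendsto_nhdsLT_of_fixed (hm _ (L.inv_mem hk)) (h.2.1 _ (L.inv_mem hk)).2)
    (h.2.1 g hg).2 (h.2.1 k hk).2
    (eventually_affine_left (hL hg) h.1) (eventually_affine_left (hL hk) h.1)

end PL

/-! ### Rigid stabilizers of subintervals of a resolvable orbital -/

/-- The elements of `G` that fix every point of `Ioo p q` outside `Ioo a b`. -/
def rigid (G : Subgroup (I ≃ₜ I)) (p q a b : I) : Subgroup (I ≃ₜ I) :=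
  fixer G (Ioo p q \ Ioo a b)

/-- The interval `Ioo p q` is a resolvable orbital of the piecewise linear group `G`. -/
structure Resolves (G : Subgroup (I ≃ₜ I)) (p q : I) : Prop where
  le_PL : G ≤ PLPlus
  lt : p < q
  orb : ∀ a b, p ≤ a → a < b → b ≤ q → IsOrb (rigid G p q a b) a b

variable {G : Subgroup (I ≃ₜ I)} {p q : I}

theorem rigid_le (G : Subgroup (I ≃ₜ I)) (p q a b : I) : rigid G p q a b ≤ G := fixer_le _ _

theorem mem_rigid_of_disjoint {a b : I} {g : I ≃ₜ I} (hg : g ∈ rigid G p q a b) {x : I}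
    (hx : x ∈ Ioo p q) (hx' : x ∉ Ioo a b) : g x = x := hg.2 x ⟨hx, hx'⟩

theorem rigid_mono {a b a' b' : I} (ha : a' ≤ a) (hb : b ≤ b') :
    rigid G p q a b ≤ rigid G p q a' b' := fun _ hg =>
  ⟨hg.1, fun x hx => hg.2 x ⟨hx.1, fun h => hx.2 ⟨ha.trans_lt h.1, h.2.trans_le hb⟩⟩⟩

theorem rigid_self (G : Subgroup (I ≃ₜ I)) (p q : I) : rigid G p q p q = G :=
  le_antisymm (rigid_le ..) fun _ hg => ⟨hg, fun _ hx => absurd hx.1 hx.2⟩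

theorem Resolves.le (h : Resolves G p q) : G ≤ HomeoPlus := h.le_PL.trans PLPlus_le_HomeoPlus

theorem Resolves.rigid_le_HomeoPlus (h : Resolves G p q) (a b : I) :
    rigid G p q a b ≤ HomeoPlus := (rigid_le ..).trans h.le

theorem Resolves.isOrb (h : Resolves G p q) : IsOrb G p q := by
  simpa [rigid_self] using h.orb p q le_rfl h.lt le_rfl

theorem Resolves.exists_moves (h : Resolves G p q) {a b x : I} (ha : p ≤ a) (hb : b ≤ q)
    (hx : x ∈ Ioo a b) : ∃ g ∈ rigid G p q a b, g x ≠ x :=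
  (h.orb a b ha (hx.1.trans hx.2) hb).2.2 x hx

theorem Resolves.apply_mem (h : Resolves G p q) {g : I ≃ₜ I} (hg : g ∈ G) {x : I}
    (hx : x ∈ Ioo p q) : g x ∈ Ioo p q := h.isOrb.apply_mem h.le hg hx

/-- The homeomorphism `g` moves a point of `Ioo p q`. -/
def Moves (p q : I) (g : I ≃ₜ I) : Prop := ∃ x ∈ Ioo p q, g x ≠ x

theorem not_moves {g : I ≃ₜ I} : ¬ Moves p q g ↔ ∀ x ∈ Ioo p q, g x = x := by
  simp [Moves]

/-! ### Normal subgroups of rigid stabilizers, modulo the elements trivial on the resolvable orbital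
-/

/-- `M` is a normal subgroup of `L`. -/
def NormalIn (M L : Subgroup (I ≃ₜ I)) : Prop :=
  M ≤ L ∧ ∀ g ∈ L, ∀ m ∈ M, g * m * g⁻¹ ∈ M

theorem NormalIn.fixer {L : Subgroup (I ≃ₜ I)} {S : Set I} (hS : ∀ g ∈ L, ∀ x ∈ S, g x ∈ S) :
    NormalIn (fixer L S) L :=
  ⟨fixer_le _ _, fun g hg m hm => ⟨L.mul_mem (L.mul_mem hg hm.1) (L.inv_mem hg), fun x hx => by
    change g (m (g⁻¹ x)) = x
    rw [hm.2 _ (hS _ (L.inv_mem hg) x hx), apply_inv_apply]⟩⟩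

theorem NormalIn.refl (L : Subgroup (I ≃ₜ I)) : NormalIn L L :=
  ⟨le_rfl, fun _ hg _ hm => L.mul_mem (L.mul_mem hg hm) (L.inv_mem hg)⟩

theorem NormalIn.commutator (L : Subgroup (I ≃ₜ I)) : NormalIn ⁅L, L⁆ L := by
  have hle : ⁅L, L⁆ ≤ L := Subgroup.commutator_le.2 fun g hg h hh =>
    L.mul_mem (L.mul_mem (L.mul_mem hg hh) (L.inv_mem hg)) (L.inv_mem hh)
  refine ⟨hle, fun g hg m hm => ?_⟩
  have h1 : g * m * g⁻¹ * m⁻¹ ∈ ⁅L, L⁆ := Subgroup.commutator_mem_commutator hg (hle hm)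
  simpa using mul_mem h1 hm

/-- A non-trivial normal subgroup of a rigid stabilizer has no fixed points. -/
theorem Resolves.exists_moves_of_normal (h : Resolves G p q) {a b : I} (ha : p ≤ a)
    (hb : b ≤ q) {M : Subgroup (I ≃ₜ I)} (hM : NormalIn M (rigid G p q a b))
    (hne : ∃ m ∈ M, Moves p q m) {y : I} (hy : y ∈ Ioo a b) : ∃ m ∈ M, m y ≠ y := by
  obtain ⟨m, hm, x, hxJ, hmx⟩ := hne
  have hx : x ∈ Ioo a b := by
    by_contra hx
    exact hmx (mem_rigid_of_disjoint (hM.1 hm) hxJ hx)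
  have hMO : M ≤ HomeoPlus := hM.1.trans (h.rigid_le_HomeoPlus a b)
  obtain ⟨e, f, hef, hxe⟩ := exists_isOrb hMO ⟨m, hm, hmx⟩
  -- Normality makes the fixed point set of `M` invariant under the rigid stabilizer.
  have fixed_apply : ∀ {z : I}, (∀ m ∈ M, m z = z) → ∀ g ∈ rigid G p q a b,
      ∀ m ∈ M, m (g z) = g z := by
    intro z hz g hg m hm
    have h1 := hz _ (hM.2 g⁻¹ (inv_mem hg) m hm)
    rw [inv_inv] at h1
    have h2 : g⁻¹ (m (g z)) = z := h1
    rw [← apply_inv_apply g (m (g z)), h2]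
  have hnot : ∀ {z : I}, z ∈ Ioo e f → ¬ ∀ m ∈ M, m z = z := by
    intro z hz hc
    obtain ⟨m, hm, hne⟩ := hef.2.2 z hz
    exact hne (hc m hm)
  -- If `a < e`, an element supported in `Ioo a x` pushes the `M`-fixed point `e` into `Ioo e f`,
  -- where `M` has no fixed points. The right endpoint is symmetric.
  have hea : e ≤ a := by
    by_contra! hc
    obtain ⟨g, hg, hlt⟩ := exists_lt_apply_of_ne (h.rigid_le_HomeoPlus a x)
      (h.exists_moves ha (hx.2.le.trans hb) ⟨hc, hxe.1⟩)
    have horb := h.orb a x ha hx.1 (hx.2.le.trans hb)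
    have hgx := (horb.apply_mem (h.rigid_le_HomeoPlus a x) hg ⟨hc, hxe.1⟩).2
    exact hnot ⟨hlt, hgx.trans hxe.2⟩
      (fixed_apply (fun m hm => (hef.2.1 m hm).1) g (rigid_mono le_rfl hx.2.le hg))
  have hfb : b ≤ f := by
    by_contra! hc
    obtain ⟨g, hg, hlt⟩ := exists_lt_apply_of_ne (h.rigid_le_HomeoPlus x b)
      (h.exists_moves (ha.trans hx.1.le) hb ⟨hxe.2, hc⟩)
    have horb := h.orb x b (ha.trans hx.1.le) hx.2 hb
    have hg' := inv_mem hg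
    have hgx := (horb.apply_mem (h.rigid_le_HomeoPlus x b) hg' ⟨hxe.2, hc⟩).1
    have hlt' := inv_apply_lt_of_lt_apply (h.rigid_le_HomeoPlus x b hg) hlt
    exact hnot ⟨hxe.1.trans hgx, hlt'⟩
      (fixed_apply (fun m hm => (hef.2.1 m hm).2) _ (rigid_mono hx.1.le le_rfl hg'))
  exact hef.2.2 y ⟨hea.trans_lt hy.1, hy.2.trans_le hfb⟩

/-- A group without fixed points centralizes no compactly supported element. -/
theorem Resolves.exists_moves_commutator (h : Resolves G p q) {M : Subgroup (I ≃ₜ I)}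
    (hMG : M ≤ G) {f : I ≃ₜ I} {c d : I}
    (hM : ∀ y ∈ Icc c d, ∃ m ∈ M, m y ≠ y) (hf : Moves p q f)
    (hsub : ∀ x ∈ Ioo p q, f x ≠ x → x ∈ Icc c d) :
    ∃ m ∈ M, Moves p q (m * f * m⁻¹ * f⁻¹) := by
  by_contra! hc
  -- If every commutator is trivial, each `m` maps the support of `f` in `Ioo p q` into itself. The
  -- supremum of that support lies in `Icc c d`, so some `m` moves it to the right, which is
  -- impossible.
  have hcomm : ∀ m ∈ M, ∀ x ∈ Ioo p q, f x ≠ x → f (m x) ≠ m x := by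
    intro m hm x hx hfx hfm
    have h1 : m (f (m⁻¹ (f⁻¹ (m x)))) = m x :=
      not_moves.1 (hc m hm) (m x) (h.apply_mem (hMG hm) hx)
    rw [inv_apply_eq_of_apply_eq hfm, inv_apply_apply] at h1
    exact hfx (m.injective h1)
  set S := {x | x ∈ Ioo p q ∧ f x ≠ x} with hS
  obtain ⟨x₀, hx₀, hfx₀⟩ := hf
  have hs1 : c ≤ sSup S := (hsub x₀ hx₀ hfx₀).1.trans (le_sSup ⟨hx₀, hfx₀⟩)
  have hs2 : sSup S ≤ d := sSup_le fun x hx => (hsub x hx.1 hx.2).2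
  obtain ⟨m, hm, hlt⟩ := exists_lt_apply_of_ne (hMG.trans h.le) (hM _ ⟨hs1, hs2⟩)
  have h2 := inv_apply_lt_of_lt_apply (h.le (hMG hm)) hlt
  obtain ⟨x, hx, hlt'⟩ := lt_sSup_iff.1 h2
  have h3 : sSup S < m x := by
    have := (h.le (hMG hm) : StrictMono m) hlt'
    rwa [apply_inv_apply] at this
  exact absurd (le_sSup (show m x ∈ S from ⟨h.apply_mem (hMG hm) hx.1, hcomm m hm x hx.1 hx.2⟩))
    h3.not_ge

theorem Resolves.exists_moves_rigid (h : Resolves G p q) {a b : I} (ha : p ≤ a) (hab : a < b)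
    (hb : b ≤ q) : ∃ g ∈ rigid G p q a b, Moves p q g := by
  obtain ⟨x, hx⟩ := exists_between hab
  obtain ⟨g, hg, hne⟩ := h.exists_moves ha hb hx
  exact ⟨g, hg, x, ⟨ha.trans_lt hx.1, hx.2.trans_le hb⟩, hne⟩

/-- A non-trivial normal subgroup of a rigid stabilizer has a non-trivial element with compact
support. -/
theorem Resolves.exists_compact (h : Resolves G p q) {a b : I} (ha : p ≤ a) (hab : a < b)
    (hb : b ≤ q) {M : Subgroup (I ≃ₜ I)} (hM : NormalIn M (rigid G p q a b))
    (hne : ∃ m ∈ M, Moves p q m) :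
    ∃ f ∈ M, Moves p q f ∧ ∃ c d, a < c ∧ d < b ∧ ∀ x ∈ Ioo p q, f x ≠ x → x ∈ Icc c d := by
  obtain ⟨c, hac, hcb⟩ := exists_between hab
  obtain ⟨d, hcd, hdb⟩ := exists_between hcb
  have hMR := hM.1
  have hMG : M ≤ G := hMR.trans (rigid_le ..)
  obtain ⟨u, hu, hmu⟩ := h.exists_moves_rigid (ha.trans hac.le) hcd (hdb.le.trans hb)
  have huR : u ∈ rigid G p q a b := rigid_mono hac.le hdb.le hu
  have hout : ∀ x ∈ Ioo p q, x ∉ Icc c d → u x = x := fun x hx hx' =>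
    mem_rigid_of_disjoint hu hx fun h => hx' (Ioo_subset_Icc_self h)
  obtain ⟨m, hm, hmov⟩ := h.exists_moves_commutator (c := c) (d := d) hMG
    (fun y hy => h.exists_moves_of_normal ha hb hM hne ⟨hac.trans_le hy.1, hy.2.trans_lt hdb⟩) hmu
    (fun x hx hne => by_contra fun hc => hne (hout x hx hc))
  have hmS : StrictMono m := h.le (hMG hm)
  have horb := h.orb a b ha hab hb
  have hmc := horb.apply_mem (h.rigid_le_HomeoPlus a b) (hMR hm) ⟨hac, hcb⟩
  have hmd := horb.apply_mem (h.rigid_le_HomeoPlus a b) (hMR hm) ⟨hac.trans hcd, hdb⟩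
  -- The commutator of `m` and `u` is in `M` by normality, and its support in `Ioo p q` lies in the
  -- union of `Icc c d` and its image under `m`.
  refine ⟨_, ?_, hmov, min c (m c), max d (m d), lt_min hac hmc.1, max_lt hdb hmd.2, ?_⟩
  · have := M.mul_mem hm (hM.2 u huR m⁻¹ (M.inv_mem hm))
    simpa [mul_assoc] using this
  · intro x hx hne
    by_contra hc
    refine hne ?_
    have h1 : u x = x := hout x hx fun hx' =>
      hc ⟨(min_le_left _ _).trans hx'.1, hx'.2.trans (le_max_left _ _)⟩
    have h2 : u (m⁻¹ x) = m⁻¹ x := by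
      refine hout _ (h.apply_mem (inv_mem (hMG hm)) hx) fun hx' => hc ?_
      have h3 := hmS.monotone hx'.1
      have h4 := hmS.monotone hx'.2
      rw [apply_inv_apply] at h3 h4
      exact ⟨(min_le_right _ _).trans h3, h4.trans (le_max_right _ _)⟩
    change m (u (m⁻¹ (u⁻¹ x))) = x
    rw [inv_apply_eq_of_apply_eq h1, h2, apply_inv_apply]

/-- A commutator of an element of `M` with one of `N` lies in both. Taking the element of `M`
compactly supported, some such commutator is non-trivial because `N` has no fixed points in `Ioo a
b`. -/
theorem Resolves.exists_moves_inf (h : Resolves G p q) {a b : I} (ha : p ≤ a) (hab : a < b)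
    (hb : b ≤ q) {M N : Subgroup (I ≃ₜ I)} (hM : NormalIn M (rigid G p q a b))
    (hN : NormalIn N (rigid G p q a b))
    (hMne : ∃ m ∈ M, Moves p q m) (hNne : ∃ m ∈ N, Moves p q m) : ∃ m ∈ M ⊓ N, Moves p q m := by
  obtain ⟨f, hf, hmov, c, d, hac, hdb, hsub⟩ := h.exists_compact ha hab hb hM hMne
  obtain ⟨m, hm, hmov'⟩ := h.exists_moves_commutator (c := c) (d := d) (hN.1.trans (rigid_le ..))
    (fun y hy => h.exists_moves_of_normal ha hb hN hNne ⟨hac.trans_le hy.1, hy.2.trans_lt hdb⟩)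
    hmov hsub
  refine ⟨_, ⟨M.mul_mem (hM.2 m (hN.1 hm) f hf) (M.inv_mem hf), ?_⟩, hmov'⟩
  have := N.mul_mem hm (hN.2 f (hM.1 hf) m⁻¹ (N.inv_mem hm))
  simpa [mul_assoc] using this

/-! ### Orbitals that determine the action on the resolvable orbital -/

/-- The interval `Ioo e f` is an orbital of the rigid stabilizer of `Ioo a b` such that the action
on it determines the action on `Ioo p q`. -/
def IsGood (G : Subgroup (I ≃ₜ I)) (p q a b e f : I) : Prop :=
  IsOrb (rigid G p q a b) e f ∧
    ∀ g ∈ rigid G p q a b, (∀ x ∈ Ioo e f, g x = x) → ¬ Moves p q g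

/-- If the action on `S` determines the action on `Ioo p q`, then so does the action on one of the
orbitals in `S`. -/
theorem Resolves.exists_isGood (h : Resolves G p q) {a b : I} (ha : p ≤ a) (hab : a < b)
    (hb : b ≤ q) {S : Set I}
    (hS : ∀ e f, IsOrb (rigid G p q a b) e f → (Ioo e f ∩ S).Nonempty → Ioo e f ⊆ S)
    (hdet : ∀ g ∈ rigid G p q a b, (∀ x ∈ S, g x = x) → ¬ Moves p q g) :
    ∃ e f, IsGood G p q a b e f ∧ Ioo e f ⊆ S := by
  by_contra! hc
  set R := rigid G p q a b with hR
  have hRO : R ≤ HomeoPlus := h.rigid_le_HomeoPlus a b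
  obtain ⟨f, hf, hmov, c, d, hac, hdb, hsub⟩ := h.exists_compact ha hab hb (NormalIn.refl _)
    (h.exists_moves_rigid ha hab hb)
  have hinv : ∀ T : Set (I × I), (∀ P ∈ T, IsOrb R P.1 P.2) →
      ∀ g ∈ R, ∀ x ∈ ⋃ P ∈ T, Ioo P.1 P.2, g x ∈ ⋃ P ∈ T, Ioo P.1 P.2 := by
    intro T hT g hg x hx
    simp only [mem_iUnion] at hx ⊢
    obtain ⟨P, hP, hx⟩ := hx
    exact ⟨P, hP, (hT P hP).apply_mem hRO hg hx⟩
  -- With no good orbital in `S`, the fixer of each orbital in `S` moves a point of `Ioo p q`. These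
  -- fixers are normal, so finite intersections of them still do.
  have hind : ∀ T : Set (I × I), T.Finite →
      (∀ P ∈ T, IsOrb R P.1 P.2 ∧ Ioo P.1 P.2 ⊆ S) →
      ∃ m ∈ fixer R (⋃ P ∈ T, Ioo P.1 P.2), Moves p q m := by
    intro T hT
    induction T, hT using Set.Finite.induction_on with
    | empty =>
      intro _
      obtain ⟨g, hg, hmg⟩ := h.exists_moves_rigid ha hab hb
      exact ⟨g, ⟨hg, by simp⟩, hmg⟩
    | @insert P T _ _ ih =>
      intro hT
      obtain ⟨hPo, hPS⟩ := hT P (mem_insert _ _)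
      have hP : ∃ m ∈ fixer R (Ioo P.1 P.2), Moves p q m := by
        by_contra! hc'
        exact hc P.1 P.2 ⟨hPo, fun g hg hx => hc' g ⟨hg, hx⟩⟩ hPS
      obtain ⟨m, hm, hmm⟩ := h.exists_moves_inf ha hab hb
        (NormalIn.fixer fun g hg x hx => hPo.apply_mem hRO hg hx)
        (NormalIn.fixer (hinv T fun Q hQ => (hT Q (mem_insert_of_mem _ hQ)).1)) hP
        (ih fun Q hQ => hT Q (mem_insert_of_mem _ hQ))
      refine ⟨m, ⟨hm.1.1, fun x hx => ?_⟩, hmm⟩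
      rw [biUnion_insert] at hx
      exact hx.elim (hm.1.2 x) (hm.2.2 x)
  -- Only the finitely many orbitals in `S` on which `f` acts non-trivially matter. An `m` trivial
  -- on them commutes with `f` on all of `S`, yet can be chosen not to commute with `f` on `Ioo p
  -- q`, against `hdet`.
  set T := {P : I × I | (IsOrb R P.1 P.2 ∧ ∃ x ∈ Ioo P.1 P.2, f x ≠ x) ∧ Ioo P.1 P.2 ⊆ S} with hT
  have hTfin : T.Finite := (finite_isOrb_moved ((rigid_le ..).trans h.le_PL) hf).subset
    fun P hP => hP.1
  have hTne := hind T hTfin fun P hP => ⟨hP.1.1, hP.2⟩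
  have hTinv := hinv T fun P hP => hP.1.1
  obtain ⟨m, hm, hmm⟩ := h.exists_moves_commutator (c := c) (d := d)
    ((fixer_le ..).trans (rigid_le ..))
    (fun y hy => h.exists_moves_of_normal ha hb (NormalIn.fixer hTinv) hTne
      ⟨hac.trans_le hy.1, hy.2.trans_lt hdb⟩) hmov hsub
  refine hdet _ (R.mul_mem (R.mul_mem (R.mul_mem hm.1 hf) (R.inv_mem hm.1)) (R.inv_mem hf))
    (fun x hx => ?_) hmm
  change m (f (m⁻¹ (f⁻¹ x))) = x
  have hmi := inv_mem hm
  have hfi := inv_mem hf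
  by_cases hxf : ∃ g ∈ R, g x ≠ x
  · obtain ⟨e, e', ho, hxe⟩ := exists_isOrb hRO hxf
    have hmf := ho.apply_mem hRO hfi hxe
    have hmm := ho.apply_mem hRO hmi.1 hxe
    by_cases hfe : ∃ y ∈ Ioo e e', f y ≠ y
    · have hin : ∀ y ∈ Ioo e e', y ∈ ⋃ P ∈ T, Ioo P.1 P.2 := fun y hy =>
        mem_biUnion (show (e, e') ∈ T from ⟨⟨ho, hfe⟩, hS _ _ ho ⟨x, hxe, hx⟩⟩) hy
      rw [hmi.2 _ (hin _ hmf), apply_inv_apply, hm.2 _ (hin _ hxe)]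
    · push Not at hfe
      rw [inv_apply_eq_of_apply_eq (hfe x hxe), hfe _ hmm, apply_inv_apply]
  · push Not at hxf
    rw [hxf _ hfi, hxf _ hmi.1, hxf _ hf, hxf _ hm.1]

theorem Resolves.exists_moves_commutator_rigid (h : Resolves G p q) {a b : I} (ha : p ≤ a)
    (hab : a < b) (hb : b ≤ q) : ∃ u ∈ rigid G p q a b, ∃ v ∈ rigid G p q a b,
      Moves p q (u * v * u⁻¹ * v⁻¹) := by
  obtain ⟨f, hf, hmov, c, d, hac, hdb, hsub⟩ := h.exists_compact ha hab hb (NormalIn.refl _)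
    (h.exists_moves_rigid ha hab hb)
  obtain ⟨m, hm, hmm⟩ := h.exists_moves_commutator (c := c) (d := d)
    (rigid_le G p q a b) (fun y hy => h.exists_moves ha hb
      ⟨hac.trans_le hy.1, hy.2.trans_lt hdb⟩) hmov hsub
  exact ⟨m, hm, f, hf, hmm⟩

/-- Rigid stabilizers are not metabelian. -/
theorem Resolves.exists_moves_commutator_commutator (h : Resolves G p q) {a b : I} (ha : p ≤ a)
    (hab : a < b) (hb : b ≤ q) :
    ∃ u ∈ ⁅rigid G p q a b, rigid G p q a b⁆, ∃ v ∈ ⁅rigid G p q a b, rigid G p q a b⁆,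
      Moves p q (u * v * u⁻¹ * v⁻¹) := by
  have hN := NormalIn.commutator (rigid G p q a b)
  have hne : ∃ m ∈ ⁅rigid G p q a b, rigid G p q a b⁆, Moves p q m := by
    obtain ⟨u, hu, v, hv, hm⟩ := h.exists_moves_commutator_rigid ha hab hb
    exact ⟨_, Subgroup.commutator_mem_commutator hu hv, hm⟩
  obtain ⟨f, hf, hmov, c, d, hac, hdb, hsub⟩ := h.exists_compact ha hab hb hN hne
  obtain ⟨m, hm, hmm⟩ := h.exists_moves_commutator (c := c) (d := d)
    (hN.1.trans (rigid_le G p q a b)) (fun y hy => h.exists_moves_of_normal ha hb hN hne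
      ⟨hac.trans_le hy.1, hy.2.trans_lt hdb⟩) hmov hsub
  exact ⟨m, hm, f, hf, hmm⟩

theorem IsOrb.exists_isOrb_of_le {L M : Subgroup (I ≃ₜ I)} (hM : M ≤ HomeoPlus) (hLM : L ≤ M)
    {e f : I} (h : IsOrb L e f) : ∃ e' f', IsOrb M e' f' ∧ e' ≤ e ∧ f ≤ f' := by
  obtain ⟨x, hx⟩ := h.nonempty
  obtain ⟨g, hg, hne⟩ := h.2.2 x hx
  obtain ⟨e', f', h', hx'⟩ := exists_isOrb hM ⟨g, hLM hg, hne⟩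
  exact ⟨e', f', h', h.le_of_fixed (fun g hg => (h'.2.1 g (hLM hg)).1)
    (fun g hg => (h'.2.1 g (hLM hg)).2) hx hx'⟩

/-- Every non-trivial normal subgroup of the rigid stabilizer of an interval meets the rigid
stabilizers of the subintervals non-trivially. -/
theorem Resolves.exists_moves_inf_rigid (h : Resolves G p q) {a b a' b' : I} (ha' : p ≤ a')
    (ha : a' ≤ a) (hab : a < b) (hb : b ≤ b') (hb' : b' ≤ q) {M : Subgroup (I ≃ₜ I)}
    (hM : NormalIn M (rigid G p q a' b')) (hne : ∃ m ∈ M, Moves p q m) :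
    ∃ m ∈ M, m ∈ rigid G p q a b ∧ Moves p q m := by
  obtain ⟨y, hy⟩ := exists_between hab
  have hMO : M ≤ HomeoPlus := hM.1.trans (h.rigid_le_HomeoPlus a' b')
  obtain ⟨m, hm, hlt⟩ := exists_lt_apply_of_ne hMO
    (h.exists_moves_of_normal ha' hb' hM hne ⟨ha.trans_lt hy.1, hy.2.trans_le hb⟩)
  have hmS : StrictMono m := hMO hm
  obtain ⟨z, hyz, hz⟩ := exists_between (lt_min hlt hy.2)
  -- the interval `Ioo y' z` is moved off itself by `m`
  obtain ⟨y', hy', hy'y⟩ : ∃ y', max a (m⁻¹ z) < y' ∧ y' < z := by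
    refine exists_between (max_lt (hy.1.trans hyz) ?_)
    exact (inv_apply_lt_of_lt_apply hmS (hz.trans_le (min_le_left _ _))).trans hyz
  have hzm : z < m y' := by
    have := hmS ((le_max_right _ _).trans_lt hy')
    rwa [apply_inv_apply] at this
  have hay' : a < y' := (le_max_left _ _).trans_lt hy'
  have hzb : z < b := hz.trans_le (min_le_right _ _)
  have hpy' : p ≤ y' := (ha'.trans ha).trans hay'.le
  have hzq : z ≤ q := hzb.le.trans (hb.trans hb')
  obtain ⟨u₀, hu₀, v, hv, x, hx, hmov⟩ := h.exists_moves_commutator_rigid hpy' hy'y hzq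
  -- The inverse is taken because the commutator of `m` with `u` acts on `Ioo y' z` as `u⁻¹`.
  obtain ⟨u, rfl⟩ : ∃ u : I ≃ₜ I, u₀ = u⁻¹ := ⟨u₀⁻¹, (inv_inv _).symm⟩
  have hu : u ∈ rigid G p q y' z := inv_mem_iff.1 hu₀
  have hincl : ∀ {u}, u ∈ rigid G p q y' z → u ∈ rigid G p q a' b' := fun hu =>
    rigid_mono (ha.trans hay'.le) (hzb.le.trans hb) hu
  have horb := h.orb y' z hpy' hy'y hzq
  have hO := h.rigid_le_HomeoPlus y' z
  have hmG : m ∈ G := rigid_le _ _ _ _ _ (hM.1 hm)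
  -- `w` acts on `Ioo y' z` as `u⁻¹`
  set w := m * u * m⁻¹ * u⁻¹ with hw
  have hwM : w ∈ M := by
    have := M.mul_mem hm (hM.2 u (hincl hu) m⁻¹ (M.inv_mem hm))
    simpa [hw, mul_assoc] using this
  have hwG : w ∈ G := rigid_le _ _ _ _ _ (hM.1 hwM)
  have hwu : ∀ x ∈ Ioo y' z, w x = u⁻¹ x := by
    intro x hx
    have hux := horb.apply_mem hO (inv_mem hu) hx
    have hJ : m⁻¹ (u⁻¹ x) ∈ Ioo p q := h.apply_mem (inv_mem hmG)
      ⟨hpy'.trans_lt hux.1, hux.2.trans_le hzq⟩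
    change m (u (m⁻¹ (u⁻¹ x))) = _
    rw [mem_rigid_of_disjoint hu hJ, apply_inv_apply]
    intro hc
    have := hmS hc.1
    rw [apply_inv_apply] at this
    exact absurd (hux.2.trans (hzm.trans this)) (lt_irrefl _)
  have hwu' : ∀ x ∈ Ioo y' z, w⁻¹ x = u x := by
    intro x hx
    have := hwu (u x) (horb.apply_mem hO hu hx)
    rw [inv_apply_apply] at this
    rw [← this, inv_apply_apply, this]
  have hconj : w * v⁻¹ * w⁻¹ ∈ rigid G p q y' z := by
    refine ⟨mul_mem (mul_mem hwG (inv_mem hv.1)) (inv_mem hwG), fun x hx => ?_⟩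
    change w (v⁻¹ (w⁻¹ x)) = x
    rw [mem_rigid_of_disjoint (inv_mem hv) (h.apply_mem (inv_mem hwG) hx.1), apply_inv_apply]
    intro hc
    have h2 := hwu _ hc
    rw [apply_inv_apply] at h2
    exact hx.2 (h2 ▸ horb.apply_mem hO (inv_mem hu) hc)
  -- The commutator of `w` and `v` is in `M` by normality, is supported within `Ioo y' z` because
  -- `w` preserves that interval, and agrees there with the non-trivial commutator of `u⁻¹` and `v`.
  refine ⟨w * (v * w⁻¹ * v⁻¹), M.mul_mem hwM (hM.2 v (hincl hv) _ (M.inv_mem hwM)), ?_, ?_⟩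
  · have h1 : w * v * w⁻¹ ∈ rigid G p q y' z := by simpa [mul_assoc] using inv_mem hconj
    have := mul_mem h1 (inv_mem hv)
    have h2 := rigid_mono hay'.le hzb.le this
    simpa [mul_assoc] using h2
  · by_contra hc
    rw [not_moves] at hc
    apply hmov
    have hxI : x ∈ Ioo y' z := by
      by_contra hxI
      apply hmov
      exact mem_rigid_of_disjoint (mul_mem (mul_mem (mul_mem hu₀ hv) (inv_mem hu₀)) (inv_mem hv))
        hx hxI
    have h1 : w (v (w⁻¹ (v⁻¹ x))) = x := hc x hx
    have h2 := horb.apply_mem hO (inv_mem hv) hxI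
    have h3 := horb.apply_mem hO hu h2
    rw [hwu' _ h2, hwu _ (horb.apply_mem hO hv h3)] at h1
    rw [inv_inv]
    exact h1

theorem IsOrb.right_eq {L : Subgroup (I ≃ₜ I)} {e f f' : I} (h : IsOrb L e f) (h' : IsOrb L e f') :
    f = f' := by
  obtain ⟨x, hx⟩ := exists_between (lt_min h.1 h'.1)
  exact (h.eq_of_mem h' ⟨hx.1, hx.2.trans_le (min_le_left _ _)⟩
    ⟨hx.1, hx.2.trans_le (min_le_right _ _)⟩).2

/-- A failure of goodness for the larger interval is a normal subgroup of its rigid stabilizer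
acting non-trivially on `Ioo p q`. By `Resolves.exists_moves_inf_rigid` it would meet the smaller
rigid stabilizer non-trivially and contradict goodness there. -/
theorem Resolves.isGood_of_le (h : Resolves G p q) {a b a' b' e f e' f' : I} (ha' : p ≤ a')
    (ha : a' ≤ a) (hab : a < b) (hb : b ≤ b') (hb' : b' ≤ q) (hg : IsGood G p q a b e f)
    (ho : IsOrb (rigid G p q a' b') e' f') (he : e' ≤ e) (hf : f ≤ f') :
    IsGood G p q a' b' e' f' := by
  refine ⟨ho, fun g hgR hgt hmov => ?_⟩
  obtain ⟨m, hm, hmR, hmm⟩ := h.exists_moves_inf_rigid ha' ha hab hb hb'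
    (NormalIn.fixer fun u hu x hx => ho.apply_mem (h.rigid_le_HomeoPlus a' b') hu hx)
    ⟨g, ⟨hgR, hgt⟩, hmov⟩
  exact hg.2 m hmR (fun x hx => hm.2 x ⟨he.trans_lt hx.1, hx.2.trans_le hf⟩) hmm

theorem Resolves.conj_mem_rigid (h : Resolves G p q) {a b : I} {g u : I ≃ₜ I} (hg : g ∈ G)
    (hu : u ∈ rigid G p q a b) : g * u * g⁻¹ ∈ rigid G p q (g a) (g b) := by
  refine ⟨mul_mem (mul_mem hg hu.1) (inv_mem hg), fun x hx => ?_⟩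
  change g (u (g⁻¹ x)) = x
  rw [mem_rigid_of_disjoint hu (h.apply_mem (inv_mem hg) hx.1), apply_inv_apply]
  intro hc
  have h1 := h.le hg hc.1
  have h2 := h.le hg hc.2
  rw [apply_inv_apply] at h1 h2
  exact hx.2 ⟨h1, h2⟩

theorem Resolves.conj_inv_mem_rigid (h : Resolves G p q) {a b : I} {g u : I ≃ₜ I} (hg : g ∈ G)
    (hu : u ∈ rigid G p q (g a) (g b)) : g⁻¹ * u * g ∈ rigid G p q a b := by
  have := h.conj_mem_rigid (inv_mem hg) hu
  rwa [inv_apply_apply, inv_apply_apply, inv_inv] at this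

theorem Resolves.isGood_conj (h : Resolves G p q) {a b e f : I} {g : I ≃ₜ I} (hg : g ∈ G)
    (hgood : IsGood G p q a b e f) : IsGood G p q (g a) (g b) (g e) (g f) := by
  have hgS : StrictMono g := h.le hg
  have fixed : ∀ {u : I ≃ₜ I} {x : I}, (g⁻¹ * u * g) x = x → u (g x) = g x := by
    intro u x hx
    have hx' : g⁻¹ (u (g x)) = x := hx
    rw [← apply_inv_apply g (u (g x)), hx']
  have fixed' : ∀ {u : I ≃ₜ I} {x : I}, u (g x) = g x → (g⁻¹ * u * g) x = x := by
    intro u x hx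
    change g⁻¹ (u (g x)) = x
    rw [hx, inv_apply_apply]
  refine ⟨⟨hgS hgood.1.1, fun u hu => ?_, fun x hx => ?_⟩, fun u hu hut => ?_⟩
  · have := hgood.1.2.1 _ (h.conj_inv_mem_rigid hg hu)
    exact ⟨fixed this.1, fixed this.2⟩
  · obtain ⟨y, rfl⟩ := g.surjective x
    obtain ⟨u, hu, hne⟩ := hgood.1.2.2 y ⟨hgS.lt_iff_lt.1 hx.1, hgS.lt_iff_lt.1 hx.2⟩
    refine ⟨_, h.conj_mem_rigid hg hu, fun hc => hne ?_⟩
    simpa [mul_assoc] using fixed' hc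
  · have h1 := hgood.2 _ (h.conj_inv_mem_rigid hg hu)
      fun x hx => fixed' (hut _ ⟨hgS hx.1, hgS hx.2⟩)
    rw [not_moves] at h1 ⊢
    intro x hx
    have := fixed (h1 _ (h.apply_mem (inv_mem hg) hx))
    rwa [apply_inv_apply] at this

/-! ### Leftmost good orbitals -/

/-- The interval `Ioo e f` is the leftmost good orbital in `Ioo k l` of the rigid stabilizer of
`Ioo a b`. -/
structure IsLeftmost (G : Subgroup (I ≃ₜ I)) (p q k l a b e f : I) : Prop where
  good : IsGood G p q a b e f
  left_le : k ≤ e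
  le_right : f ≤ l
  le_of_good : ∀ e' f', IsGood G p q a b e' f' → k ≤ e' → f' ≤ l → e ≤ e'

variable {k l : I}

theorem IsLeftmost.unique {a b e f e' f' : I} (h : IsLeftmost G p q k l a b e f)
    (h' : IsLeftmost G p q k l a b e' f') : e = e' ∧ f = f' := by
  obtain rfl := le_antisymm (h.le_of_good _ _ h'.good h'.left_le h'.le_right)
    (h'.le_of_good _ _ h.good h.left_le h.le_right)
  exact ⟨rfl, h.good.1.right_eq h'.good.1⟩

/-- The smaller group fixes `e'` and `f'`, so `Ioo e' f'` contains every orbital of it that it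
meets. It also determines the action on `Ioo p q`, so `Resolves.exists_isGood` applies to it. -/
theorem IsGood.exists_isGood (h : Resolves G p q) {a b a' b' e' f' : I} (ha' : p ≤ a')
    (ha : a' ≤ a) (hab : a < b) (hb : b ≤ b') (hb' : b' ≤ q) (hg : IsGood G p q a' b' e' f') :
    ∃ e f, IsGood G p q a b e f ∧ e' ≤ e ∧ f ≤ f' := by
  have hle := rigid_mono (G := G) (p := p) (q := q) ha hb
  obtain ⟨e, f, hgood, hsub⟩ := h.exists_isGood (ha'.trans ha) hab (hb.trans hb')
    (S := Ioo e' f') (fun e f ho ⟨x, hx, hx'⟩ =>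
      have := ho.le_of_fixed (fun g hg' => (hg.1.2.1 g (hle hg')).1)
        (fun g hg' => (hg.1.2.1 g (hle hg')).2) hx hx'
      Ioo_subset_Ioo this.1 this.2) fun g hg' => hg.2 g (hle hg')
  exact ⟨e, f, hgood, (Ioo_subset_Ioo_iff hgood.1.1).1 hsub⟩

/-- One element that moves a point of `Ioo p q` must act non-trivially on every good orbital. By
piecewise linearity there are only finitely many of them. -/
theorem exists_isLeftmost (h : Resolves G p q) (hK : IsGood G p q p q k l) {a b : I}
    (ha : p ≤ a) (hab : a < b) (hb : b ≤ q) : ∃ e f, IsLeftmost G p q k l a b e f := by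
  obtain ⟨u, hu, hmu⟩ := h.exists_moves_rigid ha hab hb
  set S := {P : I × I | IsGood G p q a b P.1 P.2 ∧ k ≤ P.1 ∧ P.2 ≤ l}
  have hfin : S.Finite := by
    refine (finite_isOrb_moved ((rigid_le ..).trans h.le_PL) hu).subset fun P hP => ⟨hP.1.1, ?_⟩
    by_contra! hc
    exact hP.1.2 u hu hc hmu
  obtain ⟨e, f, hgood, he, hf⟩ := hK.exists_isGood h le_rfl ha hab hb le_rfl
  obtain ⟨P, hP, hmin⟩ := Set.exists_min_image S Prod.fst hfin ⟨(e, f), hgood, he, hf⟩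
  exact ⟨P.1, P.2, hP.1, hP.2.1, hP.2.2, fun e' f' h1 h2 h3 => hmin (e', f') ⟨h1, h2, h3⟩⟩

/-- The choice is canonical: conjugation by `g` carries good orbitals to good orbitals, and `g`
preserves order and fixes `k` and `l`. -/
theorem IsLeftmost.conj (h : Resolves G p q) (hK : IsOrb G k l) {a b e f : I}
    (hl : IsLeftmost G p q k l a b e f) {g : I ≃ₜ I} (hg : g ∈ G) :
    IsLeftmost G p q k l (g a) (g b) (g e) (g f) := by
  have hgS : StrictMono g := h.le hg
  have hgi : StrictMono (g⁻¹ : I ≃ₜ I) := h.le (inv_mem hg)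
  refine ⟨h.isGood_conj hg hl.good, ?_, ?_, fun e' f' hgood he hf => ?_⟩
  · simpa [(hK.2.1 g hg).1] using hgS.monotone hl.left_le
  · simpa [(hK.2.1 g hg).2] using hgS.monotone hl.le_right
  · have h1 := h.isGood_conj (inv_mem hg) hgood
    rw [inv_apply_apply, inv_apply_apply] at h1
    have h2 := hl.le_of_good _ _ h1
      (by simpa only [(hK.2.1 _ (inv_mem hg)).1] using hgi.monotone he)
      (by simpa only [(hK.2.1 _ (inv_mem hg)).2] using hgi.monotone hf)
    simpa only [apply_inv_apply] using hgS.monotone h2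

/-- The orbital of the larger group around `Ioo e f` is good, so it starts no earlier than `e'`. If
it started later, a good orbital of the smaller group inside `Ioo e' f'` would force its left
endpoint, a fixed point, into `Ioo e' f'`. -/
theorem IsLeftmost.mono (h : Resolves G p q) (hK : IsOrb G k l) {a b e f a' b' e' f' : I}
    (ha' : p ≤ a') (ha : a' ≤ a) (hab : a < b) (hb : b ≤ b') (hb' : b' ≤ q)
    (hl : IsLeftmost G p q k l a b e f) (hl' : IsLeftmost G p q k l a' b' e' f') :
    e' ≤ e ∧ f ≤ f' := by
  obtain ⟨e₁, f₁, ho, he₁, hf₁⟩ := hl.good.1.exists_isOrb_of_le (h.rigid_le_HomeoPlus a' b')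
    (rigid_mono ha hb)
  obtain ⟨x, hx⟩ := hl.good.1.nonempty
  have hxo : x ∈ Ioo e₁ f₁ := ⟨he₁.trans_lt hx.1, hx.2.trans_le hf₁⟩
  have hkl := ho.le_of_fixed (fun g hg => (hK.2.1 g hg.1).1) (fun g hg => (hK.2.1 g hg.1).2) hxo
    ⟨hl.left_le.trans_lt hx.1, hx.2.trans_le hl.le_right⟩
  have hle := hl'.le_of_good _ _ (h.isGood_of_le ha' ha hab hb hb' hl.good ho he₁ hf₁) hkl.1 hkl.2
  rcases hle.eq_or_lt with rfl | hlt
  · obtain rfl := ho.right_eq hl'.good.1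
    exact ⟨he₁, hf₁⟩
  · exfalso
    obtain ⟨e₂, f₂, hgood, he₂, hf₂⟩ := hl'.good.exists_isGood h ha' ha hab hb hb'
    have h1 := hl.le_of_good _ _ hgood (hl'.left_le.trans he₂) (hf₂.trans hl'.le_right)
    obtain ⟨g, hg, hne⟩ := hl'.good.1.2.2 e₁
      ⟨hlt, he₁.trans_lt (h1.trans_lt (hgood.1.1.trans_le hf₂))⟩
    exact hne (ho.2.1 g hg).1

theorem IsLeftmost.fixed_of_disjoint (h : Resolves G p q) (hK : IsOrb G k l) {a b e f c d : I}
    (hl : IsLeftmost G p q k l a b e f) {g : I ≃ₜ I} (hg : g ∈ rigid G p q c d)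
    (hga : g a = a) (hgb : g b = b) : g e = e ∧ g f = f := by
  have := hl.conj h hK hg.1
  rw [hga, hgb] at this
  exact this.unique hl

/-- Disjoint intervals have disjoint leftmost good orbitals. -/
theorem IsLeftmost.disjoint (h : Resolves G p q) (hK : IsOrb G k l) {a b e f c d e' f' x : I}
    (ha : p ≤ a) (hab : a < b) (hbc : b ≤ c) (hcd : c < d) (hd : d ≤ q)
    (hl : IsLeftmost G p q k l a b e f) (hl' : IsLeftmost G p q k l c d e' f')
    (hx : x ∈ Ioo e f) (hx' : x ∈ Ioo e' f') : False := by
  have hfix : ∀ {c d y : I}, p ≤ y → y ≤ q → y ∉ Ioo c d → ∀ g ∈ rigid G p q c d, g y = y := by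
    intro c d y hpy hyq hy g hg
    rcases hpy.eq_or_lt with rfl | hpy
    · exact (h.isOrb.2.1 g hg.1).1
    rcases hyq.eq_or_lt with rfl | hyq
    · exact (h.isOrb.2.1 g hg.1).2
    exact mem_rigid_of_disjoint hg ⟨hpy, hyq⟩ hy
  have hV : ∀ g ∈ rigid G p q c d, g e = e ∧ g f = f := fun g hg =>
    hl.fixed_of_disjoint h hK hg
      (hfix ha (hab.le.trans (hbc.trans (hcd.le.trans hd)))
        (fun hc => (hc.1.trans_le (hab.le.trans hbc)).false) g hg)
      (hfix (ha.trans hab.le) (hbc.trans (hcd.le.trans hd)) (fun hc => (hc.1.trans_le hbc).false)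
        g hg)
  have hU : ∀ g ∈ rigid G p q a b, g e' = e' ∧ g f' = f' := fun g hg =>
    hl'.fixed_of_disjoint h hK hg
      (hfix (ha.trans (hab.le.trans hbc)) (hcd.le.trans hd) (fun hc => (hc.2.trans_le hbc).false)
        g hg)
      (hfix (ha.trans (hab.le.trans (hbc.trans hcd.le))) hd
        (fun hc => (hc.2.trans_le (hbc.trans hcd.le)).false) g hg)
  -- Each rigid stabilizer fixes the endpoints of the other's leftmost orbital, so two overlapping
  -- ones coincide.
  have h1 := hl.good.1.le_of_fixed (fun g hg => (hU g hg).1) (fun g hg => (hU g hg).2) hx hx'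
  have h2 := hl'.good.1.le_of_fixed (fun g hg => (hV g hg).1) (fun g hg => (hV g hg).2) hx' hx
  obtain rfl := le_antisymm h1.1 h2.1
  obtain rfl := le_antisymm h1.2 h2.2
  set R := rigid G p q a b
  have hRPL : R ≤ PLPlus := (rigid_le ..).trans h.le_PL
  have hRO := h.rigid_le_HomeoPlus a b
  have ho : IsOrb R _ _ := hl.good.1
  -- Taking `u` and `v` in the commutator subgroup makes them trivial near both ends of the common
  -- orbital, while their own commutator still moves a point of `Ioo p q`.
  obtain ⟨u, hu, v, hv, hmov⟩ := h.exists_moves_commutator_commutator ha hab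
    (hbc.trans (hcd.le.trans hd))
  have huR : u ∈ R := (NormalIn.commutator R).1 hu
  have hvR : v ∈ R := (NormalIn.commutator R).1 hv
  have hu' : ∀ᶠ x in 𝓝[<] f, u x = x := commutator_le_germTrivial_left hRPL ho hu
  have hv' : ∀ᶠ x in 𝓝[>] e', v x = x := commutator_le_germTrivial_right hRPL ho hv
  obtain ⟨s, hs, hsu⟩ := (mem_nhdsLT_iff_exists_Ioo_subset' ho.1).1 hu'
  obtain ⟨t, ht, htv⟩ := (mem_nhdsGT_iff_exists_Ioo_subset' ho.1).1 hv'
  obtain ⟨s', hs'⟩ := exists_between (max_lt hs ho.1)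
  obtain ⟨t', ht'⟩ := exists_between (lt_min ht ho.1)
  -- The conjugator comes from the other rigid stabilizer: it acts without fixed points on the
  -- common orbital but trivially on `Ioo a b`.
  obtain ⟨g, hg, hgt⟩ := hl'.good.1.exists_lt_apply (h.rigid_le_HomeoPlus c d)
    (x := t') (y := s') ⟨ht'.1, ht'.2.trans_le (min_le_right _ _)⟩
    ⟨(le_max_right _ _).trans_lt hs'.1, hs'.2⟩
  have hgS : StrictMono g := h.le hg.1
  -- conjugate `v` so that it becomes supported to the right of the support of `u`
  have hux : ∀ x ∈ Ioo e' f, g t' ≤ x → u x = x := fun x hx hx' =>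
    hsu ⟨((le_max_left _ _).trans_lt hs'.1).trans (hgt.trans_le hx'), hx.2⟩
  have hvx : ∀ x ∈ Ioo e' f, x ≤ g t' → (g * v * g⁻¹) x = x := by
    intro x hx hx'
    change g (v (g⁻¹ x)) = x
    have h1 := hl'.good.1.apply_mem (h.rigid_le_HomeoPlus c d) (inv_mem hg) hx
    have h2 : g⁻¹ x ≤ t' := by
      rw [← hgS.le_iff_le, apply_inv_apply]; exact hx'
    have h3 : v (g⁻¹ x) = g⁻¹ x := htv ⟨h1.1, h2.trans_lt (ht'.2.trans_le (min_le_left _ _))⟩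
    rw [h3, apply_inv_apply]
  have hwR : g * v * g⁻¹ ∈ R := by
    refine ⟨mul_mem (mul_mem hg.1 hvR.1) (inv_mem hg.1), fun x hx => ?_⟩
    change g (v (g⁻¹ x)) = x
    rw [mem_rigid_of_disjoint hvR (h.apply_mem (inv_mem hg.1) hx.1), apply_inv_apply]
    intro hc
    have h1 := mem_rigid_of_disjoint hg (h.apply_mem (inv_mem hg.1) hx.1)
      (fun h' => (hc.2.trans_le (hbc.trans h'.1.le)).false)
    rw [apply_inv_apply] at h1
    exact hx.2 (h1 ▸ hc)
  have hwJ : ∀ x ∈ Ioo p q, (g * v * g⁻¹) x = v x := by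
    intro x hx
    by_cases hxU : x ∈ Ioo a b
    · have hgf : ∀ y ∈ Ioo a b, g y = y := fun y hy =>
        mem_rigid_of_disjoint hg ⟨ha.trans_lt hy.1, hy.2.trans_le (hbc.trans (hcd.le.trans hd))⟩
          fun h' => (hy.2.trans_le (hbc.trans h'.1.le)).false
      change g (v (g⁻¹ x)) = v x
      rw [inv_apply_eq_of_apply_eq (hgf x hxU), hgf]
      exact (h.orb a b ha hab (hbc.trans (hcd.le.trans hd))).apply_mem hRO hvR hxU
    · rw [mem_rigid_of_disjoint hwR hx hxU, mem_rigid_of_disjoint hvR hx hxU]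
  set w := g * v * g⁻¹ with hw
  have hcomm : ∀ x ∈ Ioo e' f, u (w x) = w (u x) := by
    intro x hx
    have hwS : StrictMono w := hRO hwR
    have huS : StrictMono u := hRO huR
    have hgt' := hl'.good.1.apply_mem (h.rigid_le_HomeoPlus c d) hg
      (x := t') ⟨ht'.1, ht'.2.trans_le (min_le_right _ _)⟩
    rcases le_total x (g t') with hle | hle
    · rw [hvx x hx hle, hvx _ (ho.apply_mem hRO huR hx)]
      simpa only [hux _ hgt' le_rfl] using huS.monotone hle
    · rw [hux x hx hle, hux _ (ho.apply_mem hRO hwR hx)]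
      simpa only [hvx _ hgt' le_rfl] using hwS.monotone hle
  -- On the common orbital `u` and `w` commute, but on `Ioo p q` their commutator equals that of `u`
  -- and `v`. This contradicts goodness.
  refine hl.good.2 _ (mul_mem (mul_mem (mul_mem huR hwR) (inv_mem huR)) (inv_mem hwR))
    (fun x hx => ?_) ?_
  · change u (w (u⁻¹ (w⁻¹ x))) = x
    rw [hcomm _ (ho.apply_mem hRO (inv_mem huR) (ho.apply_mem hRO (inv_mem hwR) hx)),
      apply_inv_apply, apply_inv_apply]
  · obtain ⟨x, hx, hne⟩ := hmov
    refine ⟨x, hx, ?_⟩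
    have h1 : w⁻¹ x = v⁻¹ x := by
      have := hwJ _ (h.apply_mem (inv_mem hvR.1) hx)
      rw [apply_inv_apply] at this
      rw [← inv_apply_apply w (v⁻¹ x), this]
    change u (w (u⁻¹ (w⁻¹ x))) ≠ x
    rw [h1, hwJ _ (h.apply_mem (inv_mem huR.1) (h.apply_mem (inv_mem hvR.1) hx))]
    exact hne

/-! ### From families of intervals to a semiconjugacy -/

/-- The orbits in a resolvable orbital are dense. -/
theorem Resolves.exists_apply_mem (h : Resolves G p q) {a b z : I} (ha : p ≤ a) (hab : a < b)
    (hb : b ≤ q) (hz : z ∈ Ioo p q) : ∃ g ∈ G, g z ∈ Ioo a b := by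
  obtain ⟨c, hac, hcb⟩ := exists_between hab
  have hc : c ∈ Ioo p q := ⟨ha.trans_lt hac, hcb.trans_le hb⟩
  set S := {w | (∃ g ∈ G, g z = w) ∧ w ≤ c} with hS
  obtain ⟨g₀, hg₀, hlt⟩ := h.isOrb.exists_apply_lt h.le hz hc
  have hps : p < sSup S :=
    (h.apply_mem hg₀ hz).1.trans_le (le_sSup ⟨⟨g₀, hg₀, rfl⟩, hlt.le⟩)
  have hsc : sSup S ≤ c := sSup_le fun w hw => hw.2
  -- An element supported within `Ioo p b` pushes an orbit point past the supremum of the orbit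
  -- points up to `c`. The new point cannot be at most `c`, and it stays below `b`.
  obtain ⟨u, hu, hsu⟩ := exists_lt_apply_of_ne (h.rigid_le_HomeoPlus p b)
    (h.exists_moves le_rfl hb ⟨hps, hsc.trans_lt hcb⟩)
  have huG := rigid_le _ _ _ _ _ hu
  obtain ⟨w, ⟨⟨g, hg, rfl⟩, hwc⟩, hw⟩ := lt_sSup_iff.1 (inv_apply_lt_of_lt_apply (h.le huG) hsu)
  have hlt' : sSup S < u (g z) := by
    have := (h.le huG : StrictMono u) hw
    rwa [apply_inv_apply] at this
  refine ⟨u * g, mul_mem huG hg, ?_, ?_⟩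
  · by_contra! hc'
    have hle : u (g z) ≤ c := le_trans hc' hac.le
    exact absurd (le_sSup (show u (g z) ∈ S from ⟨⟨u * g, mul_mem huG hg, rfl⟩, hle⟩)) hlt'.not_ge
  · exact ((h.orb p b le_rfl (ha.trans_lt hab) hb).apply_mem (h.rigid_le_HomeoPlus p b) hu
      ⟨(h.apply_mem hg hz).1, hwc.trans_lt hcb⟩).2

/-- An increasing equivariant family of sets in a `G`-invariant interval, indexed by the
subintervals of a resolvable orbital, yields a monotone equivariant surjection. -/
theorem Resolves.exists_monotone_semiconj {β : Type*} [CompleteLinearOrder β] (h : Resolves G p q)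
    {k l : β} {B : I → I → Set β} (act : (I ≃ₜ I) → β → β)
    (hact : ∀ g ∈ G, StrictMono (act g)) (hinv : ∀ g ∈ G, ∀ x, act g (act g⁻¹ x) = x)
    (hne : ∀ {a b}, p < a → a < b → b < q → (B a b).Nonempty)
    (hsub : ∀ {a b}, p < a → a < b → b < q → B a b ⊆ Ioo k l)
    (hmono : ∀ {a b a' b'}, p < a' → a' ≤ a → a < b → b ≤ b' → b' < q → B a b ⊆ B a' b')
    (hlt : ∀ {a b c d}, p < a → a < b → b ≤ c → c < d → d < q →
      ∀ x ∈ B a b, ∀ y ∈ B c d, x < y)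
    (hcov : ∀ x ∈ Ioo k l, ∃ a b, p < a ∧ a < b ∧ b < q ∧ x ∈ B a b)
    (hconj : ∀ g ∈ G, ∀ {a b}, p < a → a < b → b < q → ∀ x ∈ B a b, act g x ∈ B (g a) (g b)) :
    ∃ ψ : β → I, Monotone ψ ∧ (∀ x ∈ Ioo k l, ψ x ∈ Ioo p q) ∧
      (∀ y ∈ Ioo p q, ∃ x ∈ Ioo k l, ψ x = y) ∧
      ∀ g ∈ G, ∀ x ∈ Ioo k l, act g x ∈ Ioo k l ∧ ψ (act g x) = g (ψ x) := by
  have hgpq : ∀ g ∈ G, ∀ {a b}, p < a → a < b → b < q → p < g a ∧ g a < g b ∧ g b < q :=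
    fun g hg a b hpa hab hbq => ⟨(h.apply_mem hg ⟨hpa, hab.trans hbq⟩).1, h.le hg hab,
      (h.apply_mem hg ⟨hpa.trans hab, hbq⟩).2⟩
  -- The value at `x` will be the supremum of the points with a neighbourhood whose associated set
  -- lies entirely below `x`.
  set S : β → Set I := fun x => {y | ∃ a b, p < a ∧ a < y ∧ y < b ∧ b < q ∧ ∀ z ∈ B a b, z < x}
    with hS
  have hψmono : Monotone fun x => sSup (S x) := fun x x' hxx' =>
    sSup_le_sSup fun y ⟨a, b, h1, h2, h3, h4, h5⟩ =>
      ⟨a, b, h1, h2, h3, h4, fun z hz => (h5 z hz).trans_le hxx'⟩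
  have hψmem : ∀ x ∈ Ioo k l, sSup (S x) ∈ Ioo p q := by
    intro x hx
    obtain ⟨a, b, hpa, hab, hbq, hxB⟩ := hcov x hx
    constructor
    · obtain ⟨y, hpy, hya⟩ := exists_between hpa
      obtain ⟨a₀, hpa₀, ha₀y⟩ := exists_between hpy
      exact hpy.trans_le (le_sSup ⟨a₀, a, hpa₀, ha₀y, hya, hab.trans hbq,
        fun z hz => hlt hpa₀ (ha₀y.trans hya) le_rfl hab hbq z hz x hxB⟩)
    · refine lt_of_le_of_lt (sSup_le ?_) hbq
      rintro y ⟨c, d, hpc, hcy, hyd, hdq, hz⟩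
      by_contra! hby
      have hd : max b c < d := (max_lt hby hcy).trans hyd
      have hp : p < max b c := hpc.trans_le (le_max_right _ _)
      obtain ⟨z, hzB⟩ := hne hp hd hdq
      have h1 := hlt hpa hab (le_max_left _ _) hd hdq x hxB z hzB
      exact absurd (hz z (hmono hpc (le_max_right _ _) hd le_rfl hdq hzB)) h1.not_gt
  have hact_mem : ∀ g ∈ G, ∀ x ∈ Ioo k l, act g x ∈ Ioo k l := by
    intro g hg x hx
    obtain ⟨a, b, hpa, hab, hbq, hxB⟩ := hcov x hx
    have := hgpq g hg hpa hab hbq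
    exact hsub this.1 this.2.1 this.2.2 (hconj g hg hpa hab hbq x hxB)
  have hle : ∀ g ∈ G, ∀ x ∈ Ioo k l, g (sSup (S x)) ≤ sSup (S (act g x)) := by
    intro g hg x hx
    have hgS : StrictMono g := h.le hg
    rw [← apply_inv_apply g (sSup (S (act g x))), hgS.le_iff_le]
    refine sSup_le ?_
    rintro y ⟨a, b, h1, h2, h3, h4, h5⟩
    rw [← hgS.le_iff_le, apply_inv_apply]
    have h6 := hgpq g hg h1 (h2.trans h3) h4
    refine le_sSup ⟨g a, g b, h6.1, hgS h2, hgS h3, h6.2.2, fun z hz => ?_⟩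
    have h7 := hconj g⁻¹ (inv_mem hg) h6.1 h6.2.1 h6.2.2 z hz
    rw [inv_apply_apply, inv_apply_apply] at h7
    rw [← hinv g hg z]
    exact hact g hg (h5 _ h7)
  have hequiv : ∀ g ∈ G, ∀ x ∈ Ioo k l, sSup (S (act g x)) = g (sSup (S x)) := by
    intro g hg x hx
    -- The reverse inequality is `hle` for the inverse of `g`.
    refine le_antisymm ?_ (hle g hg x hx)
    have h1 := hle g⁻¹ (inv_mem hg) (act g x) (hact_mem g hg x hx)
    have h2 : act g⁻¹ (act g x) = x := by
      have := hinv g⁻¹ (inv_mem hg) x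
      rwa [inv_inv] at this
    rw [h2] at h1
    have := (h.le hg : StrictMono g).monotone h1
    rwa [apply_inv_apply] at this
  refine ⟨fun x => sSup (S x), hψmono, hψmem, ?_,
    fun g hg x hx => ⟨hact_mem g hg x hx, hequiv g hg x hx⟩⟩
  have hx₀ : ∃ x₀, x₀ ∈ Ioo k l := by
    obtain ⟨a, hpa, haq⟩ := exists_between h.lt
    obtain ⟨b, hab, hbq⟩ := exists_between haq
    obtain ⟨x, hx⟩ := hne hpa hab hbq
    exact ⟨x, hsub hpa hab hbq hx⟩
  obtain ⟨x₀, hx₀⟩ := hx₀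
  have hdense : ∀ a b, p ≤ a → a < b → b ≤ q → ∃ x ∈ Ioo k l, sSup (S x) ∈ Ioo a b := by
    intro a b ha hab hb
    obtain ⟨g, hg, hgm⟩ := h.exists_apply_mem ha hab hb (hψmem x₀ hx₀)
    exact ⟨act g x₀, hact_mem g hg x₀ hx₀, by rwa [hequiv g hg x₀ hx₀]⟩
  intro y hy
  obtain ⟨x₁, hx₁, hy₁⟩ := hdense p y le_rfl hy.1 hy.2.le
  obtain ⟨x₂, hx₂, hy₂⟩ := hdense y q hy.1.le hy.2 le_rfl
  -- A monotone map with dense image has no jumps, so it takes the value `y` at the supremum of this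
  -- set.
  set T := {x | sSup (S x) ≤ y}
  have h1 : x₁ ≤ sSup T := le_sSup hy₁.2.le
  have h2 : sSup T ≤ x₂ := sSup_le fun x hx => by
    by_contra! hc
    exact absurd ((hψmono hc.le).trans hx) hy₂.1.not_ge
  have hT : sSup T ∈ Ioo k l := ⟨hx₁.1.trans_le h1, h2.trans_lt hx₂.2⟩
  refine ⟨sSup T, hT, le_antisymm ?_ ?_⟩
  · by_contra! hc
    obtain ⟨x₃, -, hx₃⟩ := hdense y (sSup (S (sSup T))) hy.1.le hc (hψmem _ hT).2.le
    have hlt : x₃ < sSup T := by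
      by_contra! hc'
      exact absurd (hψmono hc') hx₃.2.not_ge
    obtain ⟨x, hx, hxx⟩ := lt_sSup_iff.1 hlt
    exact absurd ((hψmono hxx.le).trans hx) hx₃.1.not_ge
  · by_contra! hc
    obtain ⟨x₃, -, hx₃⟩ := hdense (sSup (S (sSup T))) y (hψmem _ hT).1.le hc hy.2.le
    exact absurd (hψmono (le_sSup (show x₃ ∈ T from hx₃.2.le))) hx₃.1.not_ge

/-- The first two of three consecutive intervals determine the order of their images. -/
theorem image_le_of_image_le {β : Type*} [LinearOrder β] {e f : I → I → β}
    (hef : ∀ {a b}, p < a → a < b → b < q → e a b < f a b)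
    (hmono : ∀ {a b a' b'}, p < a' → a' ≤ a → a < b → b ≤ b' → b' < q →
      e a' b' ≤ e a b ∧ f a b ≤ f a' b')
    (hdisj : ∀ {a b c d}, p < a → a < b → b ≤ c → c < d → d < q →
      f a b ≤ e c d ∨ f c d ≤ e a b)
    {a b c d s t : I} (hpa : p < a) (hab : a < b) (hbc : b ≤ c) (hcd : c < d) (hds : d ≤ s)
    (hst : s < t) (htq : t < q) (h : f a b ≤ e c d) : f c d ≤ e s t ∧ f a b ≤ e s t := by
  have hac := hab.trans_le hbc
  have had := hac.trans hcd
  have hpc := hpa.trans hac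
  have hcs := hcd.trans_le hds
  have hct := hcs.trans hst
  have hsq := hst.trans htq
  have hdq := hds.trans_lt hsq
  have h2 := hef hpc hcd hdq
  have hl₁ := hmono hpa le_rfl hab (hbc.trans hcd.le) hdq
  have hl₂ := hmono hpa hac.le hcd le_rfl hdq
  -- The position of the third image is compared with the image of the hull `Ioo a d`, which
  -- contains the first two images.
  rcases hdisj hpa had hds hst htq with h3 | h3
  · have := hl₂.2.trans h3
    exact ⟨this, h.trans (h2.le.trans this)⟩
  -- Here the third image lies left of the first, and the second lies right of it. The image of the
  -- hull `Ioo c t` contains the second and third images, so it cannot be disjoint from the first.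
  · exfalso
    have hr₂ := hmono hpc le_rfl hcd (hds.trans hst.le) htq
    have hr₃ := hmono hpc hcs.le hst le_rfl htq
    have h1 := hef hpa hab (hbc.trans_lt (hcd.trans hdq))
    rcases hdisj hpa hab hbc hct htq with h4 | h4
    · exact absurd (h4.trans (hr₃.1.trans (hef (hpc.trans hcs) hst htq).le))
        (not_le.2 ((h3.trans hl₁.1).trans_lt h1))
    · exact absurd (hr₂.2.trans h4) (not_le.2 (h1.trans_le (h.trans h2.le)))

/-- Disjointness-preserving monotone families of intervals preserve or reverse the order. -/
theorem forall_image_le_or {β : Type*} [LinearOrder β] {e f : I → I → β}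
    (hef : ∀ {a b}, p < a → a < b → b < q → e a b < f a b)
    (hmono : ∀ {a b a' b'}, p < a' → a' ≤ a → a < b → b ≤ b' → b' < q →
      e a' b' ≤ e a b ∧ f a b ≤ f a' b')
    (hdisj : ∀ {a b c d}, p < a → a < b → b ≤ c → c < d → d < q →
      f a b ≤ e c d ∨ f c d ≤ e a b) :
    (∀ {a b c d}, p < a → a < b → b ≤ c → c < d → d < q → f a b ≤ e c d) ∨
      ∀ {a b c d}, p < a → a < b → b ≤ c → c < d → d < q → f c d ≤ e a b := by
  have hpos : ∀ {s t u a b c d}, p < s → s < t → t < u → u ≤ a → a < b → b ≤ c → c < d → d < q →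
      f s t ≤ e t u → f a b ≤ e c d := by
    intro s t u a b c d hps hst htu hua hab hbc hcd hdq h
    have h1 := image_le_of_image_le hef hmono hdisj hps hst le_rfl htu hua hab
      (hbc.trans_lt (hcd.trans hdq)) h
    exact (image_le_of_image_le hef hmono hdisj hps hst (htu.le.trans hua) hab hbc hcd hdq h1.2).1
  have hneg : ∀ {s t u a b c d}, p < s → s < t → t < u → u ≤ a → a < b → b ≤ c → c < d → d < q →
      f t u ≤ e s t → f c d ≤ e a b := by
    intro s t u a b c d hps hst htu hua hab hbc hcd hdq h
    have htri {a b c d s t : I} := image_le_of_image_le (p := p) (q := q) (β := βᵒᵈ)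
      (a := a) (b := b) (c := c) (d := d) (s := s) (t := t)
      (e := fun a b => OrderDual.toDual (f a b)) (f := fun a b => OrderDual.toDual (e a b))
      (fun h1 h2 h3 => hef h1 h2 h3)
      (fun h1 h2 h3 h4 h5 => ⟨(hmono h1 h2 h3 h4 h5).2, (hmono h1 h2 h3 h4 h5).1⟩)
      (fun h1 h2 h3 h4 h5 => (hdisj h1 h2 h3 h4 h5).symm)
    have h1 := htri hps hst le_rfl htu hua hab (hbc.trans_lt (hcd.trans hdq)) h
    exact (htri hps hst (htu.le.trans hua) hab hbc hcd hdq h1.2).1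
  by_contra! hc
  obtain ⟨⟨a, b, c, d, hpa, hab, hbc, hcd, hdq, h1⟩, a', b', c', d', hpa', hab', hbc', hcd', hdq',
    h2⟩ := hc
  -- Two adjacent reference intervals to the left of both counterexamples: the order of their images
  -- propagates to all pairs further right, refuting one counterexample or the other.
  obtain ⟨s, hps, hs⟩ := exists_between (lt_min hpa hpa')
  obtain ⟨t, hst, ht⟩ := exists_between hs
  obtain ⟨u, htu, hu⟩ := exists_between ht
  have hua := hu.le.trans (min_le_left _ _)
  have hua' := hu.le.trans (min_le_right _ _)
  rcases hdisj hps hst le_rfl htu (hua.trans_lt (hab.trans_le (hbc.trans (hcd.trans hdq).le)))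
    with h3 | h3
  · exact absurd (hpos hps hst htu hua hab hbc hcd hdq h3) h1.not_ge
  · exact absurd (hneg hps hst htu hua' hab' hbc' hcd' hdq' h3) h2.not_ge

theorem Resolves.exists_semiconj (h : Resolves G p q) {k l : I} (hK : IsGood G p q p q k l) :
    ∃ ψ : I → I, (Monotone ψ ∨ Antitone ψ) ∧ (∀ x ∈ Ioo k l, ψ x ∈ Ioo p q) ∧
      (∀ y ∈ Ioo p q, ∃ x ∈ Ioo k l, ψ x = y) ∧
      ∀ g ∈ G, ∀ x ∈ Ioo k l, g x ∈ Ioo k l ∧ ψ (g x) = g (ψ x) := by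
  have hKo : IsOrb G k l := by simpa [rigid_self] using hK.1
  have hex : ∀ a b, ∃ e f, p < a → a < b → b < q → IsLeftmost G p q k l a b e f := by
    intro a b
    by_cases hab : p < a ∧ a < b ∧ b < q
    · obtain ⟨e, f, hl⟩ := exists_isLeftmost h hK hab.1.le hab.2.1 hab.2.2.le
      exact ⟨e, f, fun _ _ _ => hl⟩
    · exact ⟨0, 0, fun h1 h2 h3 => absurd ⟨h1, h2, h3⟩ hab⟩
  choose e f hl using hex
  have hef : ∀ {a b}, p < a → a < b → b < q → e a b < f a b := fun h1 h2 h3 =>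
    (hl _ _ h1 h2 h3).good.1.1
  have hmono : ∀ {a b a' b'}, p < a' → a' ≤ a → a < b → b ≤ b' → b' < q →
      e a' b' ≤ e a b ∧ f a b ≤ f a' b' := fun h1 h2 h3 h4 h5 =>
    (hl _ _ (h1.trans_le h2) h3 (h4.trans_lt h5)).mono h hKo h1.le h2 h3 h4 h5.le
      (hl _ _ h1 (h2.trans_lt (h3.trans_le h4)) h5)
  have hdisj : ∀ {a b c d}, p < a → a < b → b ≤ c → c < d → d < q →
      f a b ≤ e c d ∨ f c d ≤ e a b := by
    intro a b c d h1 h2 h3 h4 h5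
    have hl1 := hl a b h1 h2 (h3.trans_lt (h4.trans h5))
    have hl2 := hl c d (h1.trans (h2.trans_le h3)) h4 h5
    by_contra! hc
    obtain ⟨x, hx⟩ := exists_between
      (max_lt (lt_min hl1.good.1.1 hc.2) (lt_min hc.1 hl2.good.1.1))
    rw [max_lt_iff, lt_min_iff] at hx
    exact hl1.disjoint h hKo h1.le h2 h3 h4 h5.le hl2 ⟨hx.1.1, hx.2.1⟩ ⟨hx.1.2, hx.2.2⟩
  have hsub : ∀ {a b}, p < a → a < b → b < q → k ≤ e a b ∧ f a b ≤ l := fun h1 h2 h3 =>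
    ⟨(hl _ _ h1 h2 h3).left_le, (hl _ _ h1 h2 h3).le_right⟩
  have hconj : ∀ g ∈ G, ∀ {a b}, p < a → a < b → b < q → ∀ x ∈ Ioo (e a b) (f a b),
      g x ∈ Ioo (e (g a) (g b)) (f (g a) (g b)) := by
    intro g hg a b h1 h2 h3 x hx
    have hgS : StrictMono g := h.le hg
    have h4 := (hl _ _ h1 h2 h3).conj h hKo hg
    have h5 := hl (g a) (g b) (h.apply_mem hg ⟨h1, h2.trans h3⟩).1 (hgS h2)
      (h.apply_mem hg ⟨h1.trans h2, h3⟩).2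
    obtain ⟨h6, h7⟩ := h4.unique h5
    rw [← h6, ← h7]
    exact ⟨hgS hx.1, hgS hx.2⟩
  have hcov : ∀ x ∈ Ioo k l, ∃ a b, p < a ∧ a < b ∧ b < q ∧ x ∈ Ioo (e a b) (f a b) := by
    intro x hx
    obtain ⟨a, hpa, haq⟩ := exists_between h.lt
    obtain ⟨b, hab, hbq⟩ := exists_between haq
    obtain ⟨y, hy⟩ := exists_between (hef hpa hab hbq)
    have hyK : y ∈ Ioo k l :=
      ⟨(hsub hpa hab hbq).1.trans_lt hy.1, hy.2.trans_le (hsub hpa hab hbq).2⟩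
    -- Translates of `y` lie on both sides of `x`. The image of the hull of the two translated
    -- intervals contains both points, hence `x`.
    obtain ⟨g, hg, hgx⟩ := hKo.exists_lt_apply h.le hyK hx
    obtain ⟨g', hg', hgx'⟩ := hKo.exists_apply_lt h.le hyK hx
    have haJ : a ∈ Ioo p q := ⟨hpa, haq⟩
    have hbJ : b ∈ Ioo p q := ⟨hpa.trans hab, hbq⟩
    have hpmin : p < min (g a) (g' a) := lt_min (h.apply_mem hg haJ).1 (h.apply_mem hg' haJ).1
    have hmaxq : max (g b) (g' b) < q := max_lt (h.apply_mem hg hbJ).2 (h.apply_mem hg' hbJ).2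
    have hgab : g a < g b := h.le hg hab
    have hgab' : g' a < g' b := h.le hg' hab
    refine ⟨_, _, hpmin, (min_le_left _ _).trans_lt (hgab.trans_le (le_max_left _ _)), hmaxq, ?_, ?_⟩
    · have := hmono hpmin (min_le_right _ _) hgab' (le_max_right _ _) hmaxq
      exact this.1.trans_lt ((hconj g' hg' hpa hab hbq y hy).1.trans hgx')
    · have := hmono hpmin (min_le_left _ _) hgab (le_max_left _ _) hmaxq
      exact hgx.trans ((hconj g hg hpa hab hbq y hy).2.trans_le this.2)
  rcases forall_image_le_or hef hmono hdisj with hpos | hneg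
  · obtain ⟨ψ, h1, h2, h3, h4⟩ := h.exists_monotone_semiconj (β := I) (k := k) (l := l)
      (B := fun a b => Ioo (e a b) (f a b)) (fun g x => g x) (fun g hg => h.le hg)
      (fun g _ x => apply_inv_apply g x) (fun h1 h2 h3 => exists_between (hef h1 h2 h3))
      (fun h1 h2 h3 => Ioo_subset_Ioo (hsub h1 h2 h3).1 (hsub h1 h2 h3).2)
      (fun h1 h2 h3 h4 h5 => Ioo_subset_Ioo (hmono h1 h2 h3 h4 h5).1 (hmono h1 h2 h3 h4 h5).2)
      (fun h1 h2 h3 h4 h5 x hx y hy => (hx.2.trans_le (hpos h1 h2 h3 h4 h5)).trans hy.1)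
      hcov hconj
    exact ⟨ψ, Or.inl h1, h2, h3, h4⟩
  · have hI : ∀ {x k l : I}, OrderDual.toDual x ∈ Ioo (OrderDual.toDual l) (OrderDual.toDual k) ↔
        x ∈ Ioo k l := and_comm
    -- Reversing the order on the domain only, which swaps the endpoints, turns the increasing
    -- construction into an antitone map.
    obtain ⟨ψ, h1, h2, h3, h4⟩ := h.exists_monotone_semiconj (β := Iᵒᵈ)
      (k := OrderDual.toDual l) (l := OrderDual.toDual k)
      (B := fun a b => Ioo (OrderDual.toDual (f a b)) (OrderDual.toDual (e a b)))
      (fun g x => OrderDual.toDual (g (OrderDual.ofDual x)))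
      (fun g hg x y hxy => (h.le hg : StrictMono g) hxy)
      (fun g _ x => apply_inv_apply g x) (fun h1 h2 h3 => exists_between (α := Iᵒᵈ) (hef h1 h2 h3))
      (fun h1 h2 h3 => Ioo_subset_Ioo (hsub h1 h2 h3).2 (hsub h1 h2 h3).1)
      (fun h1 h2 h3 h4 h5 => Ioo_subset_Ioo (hmono h1 h2 h3 h4 h5).2 (hmono h1 h2 h3 h4 h5).1)
      (fun h1 h2 h3 h4 h5 x hx y hy => lt_trans (lt_of_lt_of_le hx.2 (hneg h1 h2 h3 h4 h5)) hy.1)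
      (fun x hx => by
        obtain ⟨a, b, h1, h2, h3, h4⟩ := hcov (OrderDual.ofDual x) (hI.1 hx)
        exact ⟨a, b, h1, h2, h3, hI.2 h4⟩)
      (fun g hg a b h1 h2 h3 x hx => hI.2 (hconj g hg h1 h2 h3 (OrderDual.ofDual x) (hI.1 hx)))
    refine ⟨fun x => ψ (OrderDual.toDual x), Or.inr fun x y hxy => h1 hxy,
      fun x hx => h2 _ (hI.2 hx), fun y hy => ?_, fun g hg x hx => ?_⟩
    · obtain ⟨x, hx, hxy⟩ := h3 y hy
      exact ⟨OrderDual.ofDual x, hI.1 hx, hxy⟩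
    · have := h4 g hg (OrderDual.toDual x) (hI.2 hx)
      exact ⟨hI.1 this.1, this.2⟩

/-! ### The dichotomy -/

/-- A basic set around `y` inside `Ioo a b` is the trace of the support of some `g`, and this `g` is
an element of the rigid stabilizer that moves `y`. -/
theorem resolves_of_isResolvableOrbital (hG : G ≤ PLPlus) (ho : IsOrb G p q)
    (hJ : IsResolvableOrbital G (Ioo p q)) : Resolves G p q := by
  refine ⟨hG, ho.1, fun a b ha hab hb => ?_⟩
  have hO := hG.trans PLPlus_le_HomeoPlus
  refine ⟨hab, fun g hg => ?_, fun y hy => ?_⟩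
  · have : ∀ x, p ≤ x → x ≤ q → x ∉ Ioo a b → g x = x := by
      intro x hpx hxq hx
      rcases hpx.eq_or_lt with rfl | hpx
      · exact (ho.2.1 g hg.1).1
      rcases hxq.eq_or_lt with rfl | hxq
      · exact (ho.2.1 g hg.1).2
      exact mem_rigid_of_disjoint hg ⟨hpx, hxq⟩ hx
    exact ⟨this a ha (hab.le.trans hb) fun hc => hc.1.false,
      this b (ha.trans hab.le) hb fun hc => hc.2.false⟩
  · obtain ⟨V, ⟨g, hg, rfl⟩, hyV, hsub⟩ := hJ.2.exists_subset_of_mem_open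
      (a := (⟨y, ha.trans_lt hy.1, hy.2.trans_le hb⟩ : Ioo p q)) (u := Subtype.val ⁻¹' Ioo a b) hy
      (isOpen_Ioo.preimage continuous_subtype_val)
    refine ⟨g, ⟨hg, fun x hx => ?_⟩, hyV.1⟩
    by_contra hne
    exact hx.2 (hsub (show (⟨x, hx.1⟩ : Ioo p q) ∈ _ from ⟨hne, hx.1⟩))

end SemiconjDichotomy

open SemiconjDichotomy in
theorem theorem1p2 (G : Subgroup (I ≃ₜ I)) (hG : G ≤ PLPlus)
    (J : Set I) (hJ : IsResolvableOrbital G J)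
    (n : ℕ) (K : Fin n → Set I) (hK : ∀ i, IsOrbital G (K i)) :
    Xor
      (∃ g ∈ G, (supt g ∩ J).Nonempty ∧ ∀ i, Disjoint (supt g) (K i))
      (∃ (i : Fin n) (ψ : K i → J), (Monotone ψ ∨ Antitone ψ) ∧ Function.Surjective ψ ∧
        IsEquivariantMap G (K i) (fun x => (ψ x : I))) := by
  have hO := hG.trans PLPlus_le_HomeoPlus
  obtain ⟨p, q, hpq, rfl⟩ := exists_isOrb_of_isOrbital hO hJ.1
  have h := resolves_of_isResolvableOrbital hG hpq hJ
  by_cases h1 : ∃ g ∈ G, (supt g ∩ Set.Ioo p q).Nonempty ∧ ∀ i, Disjoint (supt g) (K i)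
  · refine Or.inl ⟨h1, ?_⟩
    obtain ⟨g, hg, ⟨y, hgy, hy⟩, hdisj⟩ := h1
    rintro ⟨i, ψ, -, hsurj, hequiv⟩
    obtain ⟨x, hx⟩ := hsurj ⟨y, hy⟩
    obtain ⟨hgx, heq⟩ := hequiv g hg x
    have hfix : g x = x := by
      by_contra hne
      exact Set.disjoint_left.1 (hdisj i) hne x.2
    have h2 : (⟨g x, hgx⟩ : K i) = x := Subtype.ext hfix
    simp only [h2, hx] at heq
    exact hgy heq.symm
  · refine Or.inr ⟨?_, h1⟩
    choose e f hKo hKe using fun i => exists_isOrb_of_isOrbital hO (hK i)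
    obtain rfl : K = fun i => Set.Ioo (e i) (f i) := funext hKe
    -- The failure of the first alternative says precisely that the action on the union of the `K i`
    -- determines the action on `J`. The resulting good orbital of `G` must be one of the `K i`.
    have key := h.exists_isGood le_rfl h.lt le_rfl (S := ⋃ i, Set.Ioo (e i) (f i))
      (by
        rintro e' f' ho ⟨x, hx, hx'⟩
        rw [rigid_self] at ho
        obtain ⟨i, hi⟩ := Set.mem_iUnion.1 hx'
        obtain ⟨rfl, rfl⟩ := ho.eq_of_mem (hKo i) hx hi
        exact Set.subset_iUnion (fun i => Set.Ioo (e i) (f i)) i)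
      (by
        rintro g hg hfix ⟨y, hy, hne⟩
        refine h1 ⟨g, rigid_le _ _ _ _ _ hg, ⟨y, hne, hy⟩, fun i => Set.disjoint_left.2 ?_⟩
        exact fun x hx hxi => hx (hfix x (Set.mem_iUnion.2 ⟨i, hxi⟩)))
    obtain ⟨k, l, hgood, hsub⟩ := key
    obtain ⟨x, hx⟩ := hgood.1.nonempty
    obtain ⟨i, hi⟩ := Set.mem_iUnion.1 (hsub hx)
    have hkl := hgood.1
    rw [rigid_self] at hkl
    obtain ⟨rfl, rfl⟩ := hkl.eq_of_mem (hKo i) hx hi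
    obtain ⟨ψ, hmon, hmem, hsurj, hequiv⟩ := h.exists_semiconj hgood
    refine ⟨i, fun x => ⟨ψ x, hmem x x.2⟩, ?_, ?_, ?_⟩
    · exact hmon.imp (fun hm x y hxy => hm hxy) fun hm x y hxy => hm hxy
    · rintro ⟨y, hy⟩
      obtain ⟨x, hx, rfl⟩ := hsurj y hy
      exact ⟨⟨x, hx⟩, rfl⟩
    · exact fun g hg x => ⟨(hequiv g hg x x.2).1, (hequiv g hg x x.2).2⟩
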